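/- Let $M>0$ and let $(\mathcal M,g)$ be the maximal Schwarzschild--Kruskal space-time of mass $M$, i.e. $\mathcal M=\{(T,X,\omega)\in\mathbb R\times\mathbb R\times S^2:\ T^2-X^2<1\}$ with the Lorentzian metric $$g=\frac{32M^3}{r}\,e^{-r/2M}\,(-dT^2+dX^2)+r^2\,d\Omega^2,$$ where $d\Omega^2$ is the round metric of the unit sphere $S^2$ and $r=r(T,X)>0$ is determined by $X^2-T^2=\left(\frac r{2M}-1\right)e^{r/2M}$. Let $\mathcal B^+=\{T\ge|X|\}$ and $\mathcal B^-=\{T\le-|X|\}$ be the future and past black hole regions, whose interiors are the two components of $\{r<2M\}$. Let $k>2$ and let $\Sigma\subset\mathcal M$ be an embedded hypersurface of class $C^k$ which is time-symmetric, that is, $\Sigma$ is spacelike and its extrinsic curvature vanishes at every point: $K(u,v)=g(v,\nabla_u N)=0$ for all vectors $u,v$ tangent to $\Sigma$, where $N$ is a (local) unit timelike normal field of $\Sigma$, $g(N,N)=-1$, and $\nabla$ is the Levi-Civita connection of $g$. Then $\Sigma$ does not intersect the interior of $\mathcal B^+$ nor the interior of $\mathcal B^-$. -/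

import Mathlib

open Set Filter Topology

noncomputable section

/-! ### Pseudo-Riemannian geometry of an open subset of a vector space

Tensor fields are given by their components in the global chart, i.e. a metric is a function `g`
from points to continuous bilinear forms, a vector field is a function `N : E → E`. -/

section Geometry

variable {E : Type*} [NormedAddCommGroup E] [NormedSpace ℝ E]

/-- Christoffel symbols of the first kind, as a linear form in the last slot `w`:
`[u, v; w] = (1/2) (∂_u g(v, w) + ∂_v g(u, w) - ∂_w g(u, v))`. -/
def christoffelFirst (g : E → E →L[ℝ] E →L[ℝ] ℝ) (p u v : E) : E →L[ℝ] ℝ :=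
  (1 / 2 : ℝ) •
    (fderiv ℝ g p u v + fderiv ℝ g p v u - ((fderiv ℝ g p).flip u).flip v)

theorem christoffelFirst_apply (g : E → E →L[ℝ] E →L[ℝ] ℝ) (p u v w : E) :
    christoffelFirst g p u v w =
      (1 / 2) * (fderiv ℝ g p u v w + fderiv ℝ g p v u w - fderiv ℝ g p w u v) := by
  simp [christoffelFirst]

/-- Christoffel symbols `Γ(u, v)` of the Levi-Civita connection: the first index of
`christoffelFirst` is raised with the inverse of the metric. -/
def christoffel (g : E → E →L[ℝ] E →L[ℝ] ℝ) (p u v : E) : E :=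
  (g p).inverse (christoffelFirst g p u v)

/-- The Levi-Civita covariant derivative `∇_u N` at `p`. -/
def covariantDeriv (g : E → E →L[ℝ] E →L[ℝ] ℝ) (N : E → E) (p u : E) : E :=
  fderiv ℝ N p u + christoffel g p u (N p)

/-- Tangent vectors to the set `S` at `p`: velocities at `p` of curves that run in `S`.
For an embedded submanifold this is the usual tangent space. -/
def tangentVectors (S : Set E) (p : E) : Set E :=
  {v | ∃ γ : ℝ → E, γ 0 = p ∧ (∀ᶠ t in 𝓝 (0 : ℝ), γ t ∈ S) ∧ HasDerivAt γ v 0}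

/-- `S` is an embedded hypersurface of class `C^k` of the open set `O`: near each of its points it
is the zero set of a `C^k` function with nonzero differential at the point. It need be neither
closed in `O` nor connected. -/
def IsEmbeddedHypersurface (k : WithTop ℕ∞) (O S : Set E) : Prop :=
  S ⊆ O ∧ ∀ p ∈ S, ∃ (W : Set E) (f : E → ℝ), IsOpen W ∧ p ∈ W ∧ W ⊆ O ∧
    ContDiffOn ℝ k f W ∧ fderiv ℝ f p ≠ 0 ∧ S ∩ W = {q ∈ W | f q = 0}

/-- The first fundamental form of `S` is positive definite at each point. -/
def IsSpacelike (g : E → E →L[ℝ] E →L[ℝ] ℝ) (S : Set E) : Prop :=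
  ∀ p ∈ S, ∀ v ∈ tangentVectors S p, v ≠ 0 → 0 < g p v v

/-- On the open set `W`, the `C^1` vector field `N` restricts to a unit timelike normal field of
`S`; off `S` it is an arbitrary `C^1` extension. -/
structure IsUnitNormalField (g : E → E →L[ℝ] E →L[ℝ] ℝ) (S W : Set E) (N : E → E) : Prop where
  contDiffOn : ContDiffOn ℝ 1 N W
  unit : ∀ q ∈ S ∩ W, g q (N q) (N q) = -1
  normal : ∀ q ∈ S ∩ W, ∀ v ∈ tangentVectors S q, g q (N q) v = 0

/-- The extrinsic curvature `K(u, v) = g(v, ∇_u N)` at `p`, for `u`, `v` tangent to the hypersurface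
with unit normal field `N`. -/
def extrinsicCurvature (g : E → E →L[ℝ] E →L[ℝ] ℝ) (N : E → E) (p u v : E) : ℝ :=
  g p v (covariantDeriv g N p u)

/-- The extrinsic curvature of `S` (with respect to any local unit normal field) vanishes at each
point of `S`. -/
def HasZeroExtrinsicCurvature (g : E → E →L[ℝ] E →L[ℝ] ℝ) (S : Set E) : Prop :=
  ∀ p ∈ S, ∀ (W : Set E) (N : E → E), IsOpen W → p ∈ W → IsUnitNormalField g S W N →
    ∀ u ∈ tangentVectors S p, ∀ v ∈ tangentVectors S p, extrinsicCurvature g N p u v = 0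

/-- A time-symmetric hypersurface: spacelike with vanishing extrinsic curvature. -/
structure IsTimeSymmetric (g : E → E →L[ℝ] E →L[ℝ] ℝ) (S : Set E) : Prop where
  spacelike : IsSpacelike g S
  zero_curvature : HasZeroExtrinsicCurvature g S

end Geometry

/-! ### The Kruskal space-time

As a manifold this is `{(T, X, ω) ∈ ℝ × ℝ × S² | T² - X² < 1}`. It has a global chart:
`(T, X, ω)` is represented by `(T, y)` with `y = e^X ω ∈ ℝ³ \ {0}`, so that
`X = log ‖y‖` and `ω = y / ‖y‖`. -/

namespace Kruskal

/-- The vector space `ℝ × ℝ³` in which the global chart `(T, y)` takes its values. -/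
abbrev Coord : Type := ℝ × EuclideanSpace ℝ (Fin 3)

/-- The Kruskal time coordinate `T`. -/
def timeT (p : Coord) : ℝ := p.1

/-- The Kruskal space coordinate `X`. -/
def spaceX (p : Coord) : ℝ := Real.log ‖p.2‖

/-- The angular position `ω`, a unit vector of `ℝ³`. -/
def angle (p : Coord) : EuclideanSpace ℝ (Fin 3) := ‖p.2‖⁻¹ • p.2

/-- The Kruskal manifold, in the global chart. -/
def spacetime : Set Coord := {p | p.2 ≠ 0 ∧ timeT p ^ 2 - spaceX p ^ 2 < 1}

/-- The chart is a bijection between `spacetime` and `{T² - X² < 1} × S²`. -/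
theorem bijOn_chart :
    BijOn (fun p : Coord => (timeT p, spaceX p, angle p)) spacetime
      {q : ℝ × ℝ × EuclideanSpace ℝ (Fin 3) | q.1 ^ 2 - q.2.1 ^ 2 < 1 ∧ ‖q.2.2‖ = 1} := by
  refine ⟨?_, ?_, ?_⟩
  · rintro ⟨T, y⟩ ⟨hy, h⟩
    exact ⟨h, by simpa [angle] using norm_smul_inv_norm (𝕜 := ℝ) hy⟩
  · rintro ⟨T, y⟩ ⟨hy, -⟩ ⟨T', y'⟩ ⟨hy', -⟩ h
    simp only [timeT, spaceX, angle, Prod.mk.injEq] at h hy hy' ⊢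
    obtain ⟨h1, h2, h3⟩ := h
    have h4 : ‖y‖ = ‖y'‖ :=
      Real.log_injOn_pos (norm_pos_iff.2 hy) (norm_pos_iff.2 hy') h2
    rw [h4] at h3
    exact ⟨h1, smul_right_injective _ (inv_ne_zero (norm_ne_zero_iff.2 hy')) h3⟩
  · rintro ⟨T, X, ω⟩ ⟨h, hω⟩
    simp only at h hω
    have hn : ‖Real.exp X • ω‖ = Real.exp X := by
      rw [norm_smul, hω, mul_one, Real.norm_eq_abs, Real.abs_exp]
    have hX : spaceX (T, Real.exp X • ω) = X := by simp only [spaceX, hn, Real.log_exp]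
    refine ⟨(T, Real.exp X • ω), ⟨?_, ?_⟩, ?_⟩
    · exact norm_ne_zero_iff.1 (by simp only [hn]; exact (Real.exp_pos X).ne')
    · simpa only [hX, timeT] using h
    · have hA : angle (T, Real.exp X • ω) = ω := by
        simp only [angle, hn, smul_smul]
        rw [inv_mul_cancel₀ (Real.exp_pos X).ne', one_smul]
      simp only [hX, hA, timeT]

/-- The function `s ↦ (s - 1) e^s`, with which the area radius is `X² - T² = kruskalFun (r / 2M)`. -/
def kruskalFun (s : ℝ) : ℝ := (s - 1) * Real.exp s

theorem strictMonoOn_kruskalFun : StrictMonoOn kruskalFun (Ici 0) := by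
  refine strictMonoOn_of_deriv_pos (convex_Ici 0)
    (by unfold kruskalFun; fun_prop) fun s hs => ?_
  rw [interior_Ici, mem_Ioi] at hs
  have h : HasDerivAt kruskalFun (1 * Real.exp s + (s - 1) * Real.exp s) s :=
    ((hasDerivAt_id s).sub_const 1).mul (Real.hasDerivAt_exp s)
  rw [h.deriv]
  have := mul_pos hs (Real.exp_pos s)
  linarith

theorem bijOn_kruskalFun : BijOn kruskalFun (Ioi 0) (Ioi (-1)) := by
  have h0 : kruskalFun 0 = -1 := by simp [kruskalFun]
  refine ⟨fun s hs => ?_, (strictMonoOn_kruskalFun.mono Ioi_subset_Ici_self).injOn,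
    fun c hc => ?_⟩
  · rw [mem_Ioi, ← h0]
    exact strictMonoOn_kruskalFun self_mem_Ici (Ioi_subset_Ici_self hs) hs
  · rw [mem_Ioi] at hc
    have hb : c < kruskalFun (c + 2) := by
      have h1 : 1 ≤ Real.exp (c + 2) := Real.one_le_exp (by linarith)
      have h2 : 0 < c + 2 - 1 := by linarith
      unfold kruskalFun
      nlinarith
    obtain ⟨s, hs, rfl⟩ := intermediate_value_Ioo (a := 0) (b := c + 2) (by linarith)
      (f := kruskalFun) (by unfold kruskalFun; fun_prop) ⟨by rw [h0]; exact hc, hb⟩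
    exact ⟨s, hs.1, rfl⟩

/-- The area radius `r`: the unique `r > 0` with `X² - T² = (r / 2M - 1) e^(r / 2M)`. -/
def radius (M : ℝ) (p : Coord) : ℝ :=
  2 * M * Function.invFunOn kruskalFun (Ioi 0) (spaceX p ^ 2 - timeT p ^ 2)

theorem radius_spec {M : ℝ} (hM : 0 < M) {p : Coord} (hp : p ∈ spacetime) {r : ℝ} :
    r = radius M p ↔ 0 < r ∧
      spaceX p ^ 2 - timeT p ^ 2 = (r / (2 * M) - 1) * Real.exp (r / (2 * M)) := by
  have h2 : 0 < 2 * M := by linarith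
  have hc : spaceX p ^ 2 - timeT p ^ 2 ∈ kruskalFun '' Ioi 0 := by
    rw [bijOn_kruskalFun.image_eq, mem_Ioi]
    have := hp.2
    linarith
  have hpos : 0 < Function.invFunOn kruskalFun (Ioi 0) (spaceX p ^ 2 - timeT p ^ 2) :=
    Function.invFunOn_mem hc
  have heq := Function.invFunOn_eq hc
  constructor
  · rintro rfl
    refine ⟨mul_pos h2 hpos, ?_⟩
    rw [radius, mul_div_cancel_left₀ _ h2.ne']
    exact heq.symm
  · rintro ⟨hr, h⟩
    have := bijOn_kruskalFun.injOn (show r / (2 * M) ∈ Ioi 0 from div_pos hr h2)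
      (show _ ∈ Ioi (0 : ℝ) from hpos) (h.symm.trans heq.symm)
    rw [radius, ← this, mul_div_cancel₀ _ h2.ne']

/-- The Kruskal metric of mass `M`,
`(32 M³ / r) e^(-r / 2M) (-dT² + dX²) + r² dΩ²`,
where `dΩ² = dω₁² + dω₂² + dω₃²` is the round metric of the unit sphere. -/
def metric (M : ℝ) (p : Coord) : Coord →L[ℝ] Coord →L[ℝ] ℝ :=
  (32 * M ^ 3 / radius M p * Real.exp (-radius M p / (2 * M))) •
      (-(fderiv ℝ timeT p).smulRight (fderiv ℝ timeT p)
        + (fderiv ℝ spaceX p).smulRight (fderiv ℝ spaceX p))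
    + (radius M p ^ 2) • ∑ i : Fin 3,
        (fderiv ℝ (fun q => angle q i) p).smulRight (fderiv ℝ (fun q => angle q i) p)

theorem metric_apply (M : ℝ) (p v w : Coord) :
    metric M p v w =
      32 * M ^ 3 / radius M p * Real.exp (-radius M p / (2 * M)) *
          (-(fderiv ℝ timeT p v * fderiv ℝ timeT p w)
            + fderiv ℝ spaceX p v * fderiv ℝ spaceX p w)
        + radius M p ^ 2 *
          ∑ i : Fin 3, fderiv ℝ (fun q => angle q i) p v * fderiv ℝ (fun q => angle q i) p w := by
  simp [metric]
  ring

/-- The future black hole region `B⁺` (with its boundary, the horizon `T = |X|`). -/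
def futureBlackHole : Set Coord := {p ∈ spacetime | |spaceX p| ≤ timeT p}

/-- The past black hole region `B⁻` (with its boundary, the horizon `T = -|X|`). -/
def pastBlackHole : Set Coord := {p ∈ spacetime | timeT p ≤ -|spaceX p|}

end Kruskal

end

/-! Vanishing extrinsic curvature together with g(N, N) = -1 makes the unit normal N parallel along
S (`parallel_of_zero_curvature`), and the proof exploits the integrability of ∇_u N = 0. Write s =
r/2M, ν = dω(N) and y = ds(N). The angular and radial components of the equation
(`angular_parallel`, `radial_parallel`) combine into one identity in ℝ³ for ζ = sν + yω: dζ(u) =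
-(3/2)⟨ν, dω(u)⟩ ω for u tangent to S (`fderiv_angularField`). Symmetry of the second derivative of
ζ then says that ⟨ν, dω⟩ ∧ dω vanishes modulo ω (`mul_inner_fderiv_comm_of_fderiv_eq_smul`). Since S
is spacelike while ∂_T is timelike with dω(∂_T) = 0, S submerses onto the sphere; so dω takes on
tangent vectors of S both the value ν and a nonzero value orthogonal to ν and ω, which forces ν = 0
(`fderiv_angle_normal_eq_zero`).

Once ν = 0 all along S, the angular equation reduces to y dω(u) = 0, hence y = 0: the timelike
vector N is tangent to the level sets of r. Where X² ≤ T² and T ≠ 0 the gradient of r is causal and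
nonzero, so it cannot be orthogonal to N (`not_sq_le_sq_of_isTimeSymmetric`). Points with T = 0 are
not interior to either black hole region.

Three derivatives of the defining function give N, and hence ζ, two derivatives, as the symmetry
argument needs. -/

noncomputable section

/-! ### Metrics that are diagonal in a family of possibly dependent functions -/

section Geometry

variable {E : Type*} [NormedAddCommGroup E] [NormedSpace ℝ E]

/-- The metric `∑ c_a dψ_a ⊗ dψ_a`. -/
def diagonalMetric {ι : Type*} [Fintype ι] (c ψ : ι → E → ℝ) (p : E) : E →L[ℝ] E →L[ℝ] ℝ :=
  ∑ a, c a p • (fderiv ℝ (ψ a) p).smulRight (fderiv ℝ (ψ a) p)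

section Diagonal

variable {ι : Type*} [Fintype ι] {c ψ : ι → E → ℝ} {p : E}

theorem diagonalMetric_apply (c ψ : ι → E → ℝ) (p v w : E) :
    diagonalMetric c ψ p v w =
      ∑ a, c a p * (fderiv ℝ (ψ a) p v * fderiv ℝ (ψ a) p w) := by
  simp [diagonalMetric]

set_option maxSynthPendingDepth 3 in
theorem contDiffAt_diagonalMetric {n m : WithTop ℕ∞} (hnm : n + 1 ≤ m)
    (hc : ∀ a, ContDiffAt ℝ n (c a) p)
    (hψ : ∀ a, ContDiffAt ℝ m (ψ a) p) : ContDiffAt ℝ n (diagonalMetric c ψ) p := by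
  unfold diagonalMetric
  refine ContDiffAt.sum fun a _ => ?_
  have h := (hψ a).fderiv_right hnm
  have h2 : ContDiffAt ℝ n
      (fun q => (fderiv ℝ (ψ a) q).smulRight (fderiv ℝ (ψ a) q)) p := h.smulRight h
  exact ContDiffAt.smul (hc a) h2

theorem fderiv_diagonalMetric (hc : ∀ a, ContDiffAt ℝ 1 (c a) p)
    (hψ : ∀ a, ContDiffAt ℝ 2 (ψ a) p) (u v w : E) :
    fderiv ℝ (diagonalMetric c ψ) p u v w =
      ∑ a, (fderiv ℝ (c a) p u * (fderiv ℝ (ψ a) p v * fderiv ℝ (ψ a) p w) +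
        c a p * (fderiv ℝ (fderiv ℝ (ψ a)) p u v * fderiv ℝ (ψ a) p w +
          fderiv ℝ (ψ a) p v * fderiv ℝ (fderiv ℝ (ψ a)) p u w)) := by
  have hg : DifferentiableAt ℝ (diagonalMetric c ψ) p :=
    (contDiffAt_diagonalMetric (n := 1) (m := 2) (by norm_num) hc hψ).differentiableAt (by simp)
  have h1 : HasFDerivAt (fun q => diagonalMetric c ψ q v w)
      (((fderiv ℝ (diagonalMetric c ψ) p).flip v).flip w) p := by
    have := (hg.hasFDerivAt.clm_apply (hasFDerivAt_const v p)).clm_apply (hasFDerivAt_const w p)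
    refine this.congr_fderiv ?_
    ext u
    simp
  have hd : ∀ a, HasFDerivAt (fderiv ℝ (ψ a)) (fderiv ℝ (fderiv ℝ (ψ a)) p) p := fun a =>
    (((hψ a).fderiv_right (m := 1) (by norm_num)).differentiableAt (by simp)).hasFDerivAt
  have hdv : ∀ a (v : E), HasFDerivAt (fun q => fderiv ℝ (ψ a) q v)
      ((fderiv ℝ (fderiv ℝ (ψ a)) p).flip v) p := fun a v => by
    refine ((hd a).clm_apply (hasFDerivAt_const v p)).congr_fderiv ?_
    ext u
    simp
  have h2 : HasFDerivAt (fun q => diagonalMetric c ψ q v w)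
      (∑ a, (c a p • (fderiv ℝ (ψ a) p v • (fderiv ℝ (fderiv ℝ (ψ a)) p).flip w +
        fderiv ℝ (ψ a) p w • (fderiv ℝ (fderiv ℝ (ψ a)) p).flip v) +
        (fderiv ℝ (ψ a) p v * fderiv ℝ (ψ a) p w) • fderiv ℝ (c a) p)) p := by
    simp_rw [diagonalMetric_apply]
    exact HasFDerivAt.fun_sum fun a _ =>
      ((hc a).differentiableAt (by simp)).hasFDerivAt.mul ((hdv a v).mul (hdv a w))
  have h3 := congrArg (fun L : E →L[ℝ] ℝ => L u) (h1.unique h2)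
  simp only [ContinuousLinearMap.flip_apply, sum_apply, add_apply,
    smul_apply, smul_eq_mul] at h3
  rw [h3]
  refine Finset.sum_congr rfl fun a _ => ?_
  ring

/-- The form `g(v, ∇_u N)` of a diagonal metric in terms of the components `dψ_a(N)`. -/
theorem diagonalMetric_add_christoffelFirst (hc : ∀ a, ContDiffAt ℝ 1 (c a) p)
    (hψ : ∀ a, ContDiffAt ℝ 2 (ψ a) p) {N : E → E} (hN : DifferentiableAt ℝ N p) (u v : E) :
    diagonalMetric c ψ p v (fderiv ℝ N p u) +
        christoffelFirst (diagonalMetric c ψ) p u (N p) v =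
      ∑ a, (c a p * fderiv ℝ (ψ a) p v * fderiv ℝ (fun q => fderiv ℝ (ψ a) q (N q)) p u +
        1 / 2 * (fderiv ℝ (c a) p u * fderiv ℝ (ψ a) p (N p) * fderiv ℝ (ψ a) p v +
          fderiv ℝ (c a) p (N p) * fderiv ℝ (ψ a) p u * fderiv ℝ (ψ a) p v -
          fderiv ℝ (c a) p v * fderiv ℝ (ψ a) p u * fderiv ℝ (ψ a) p (N p))) := by
  have hd : ∀ a, fderiv ℝ (fun q => fderiv ℝ (ψ a) q (N q)) p u =
      fderiv ℝ (fderiv ℝ (ψ a)) p u (N p) + fderiv ℝ (ψ a) p (fderiv ℝ N p u) := fun a => by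
    have := (((hψ a).fderiv_right (m := 1) (by norm_num)).differentiableAt
      (by simp)).hasFDerivAt.clm_apply hN.hasFDerivAt
    rw [this.fderiv]
    simp [add_comm]
  have hs : ∀ a (x y : E), fderiv ℝ (fderiv ℝ (ψ a)) p x y = fderiv ℝ (fderiv ℝ (ψ a)) p y x :=
    fun a => (hψ a).isSymmSndFDerivAt (by simp)
  rw [christoffelFirst_apply, diagonalMetric_apply, fderiv_diagonalMetric hc hψ,
    fderiv_diagonalMetric hc hψ, fderiv_diagonalMetric hc hψ, ← Finset.sum_add_distrib,
    ← Finset.sum_sub_distrib, Finset.mul_sum, ← Finset.sum_add_distrib]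
  refine Finset.sum_congr rfl fun a _ => ?_
  rw [hd, hs a (N p) u, hs a v u, hs a v (N p)]
  ring

end Diagonal

/-! ### Level sets, their parametrizations and tangent vectors -/

section Hypersurface

variable {f : E → ℝ} {p : E} {k : WithTop ℕ∞} {S : Set E}

/-- A level set of a submersion has a local parametrization by the ambient space, whose derivative
at the base point is the identity on the tangent space. -/
theorem exists_parametrization [CompleteSpace E] {W : Set E} (hW : IsOpen W) (hp : p ∈ W) (hk : 1 ≤ k)
    (hf : ContDiffOn ℝ k f W) (hdf : fderiv ℝ f p ≠ 0) (h0 : f p = 0) :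
    ∃ φ : E → E, φ 0 = p ∧ ContDiffAt ℝ k φ 0 ∧ (∀ᶠ s in 𝓝 0, φ s ∈ W ∧ f (φ s) = 0) ∧
      ∀ v, fderiv ℝ f p v = 0 → fderiv ℝ φ 0 v = v := by
  have hfp : ContDiffAt ℝ k f p := hf.contDiffAt (hW.mem_nhds hp)
  set l := fderiv ℝ f p with hl
  obtain ⟨e, he⟩ : ∃ e, l e = 1 := by
    obtain ⟨x, hx⟩ : ∃ x, l x ≠ 0 := by
      by_contra! h
      exact hdf (ContinuousLinearMap.ext h)
    exact ⟨(l x)⁻¹ • x, by simp [hx]⟩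
  -- Since l e = 1, one has l (F q) = l p + f q: the map F straightens the level sets of f into
  -- those of l, and its derivative at p is the identity.
  let F : E → E := fun q => q + (f q - l (q - p)) • e
  have hF : ContDiffAt ℝ k F p := by
    refine contDiffAt_id.add ((hfp.sub ?_).smul contDiffAt_const)
    exact l.contDiff.contDiffAt.comp p (contDiffAt_id.sub contDiffAt_const)
  have hF' : HasFDerivAt F ((ContinuousLinearEquiv.refl ℝ E : E ≃L[ℝ] E) : E →L[ℝ] E) p := by
    have h1 : HasFDerivAt f l p :=
      (hfp.differentiableAt (by intro h; simp [h] at hk)).hasFDerivAt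
    have h2 : HasFDerivAt (fun q => l (q - p)) l p :=
      l.hasFDerivAt.comp p ((hasFDerivAt_id p).sub_const p)
    have := (hasFDerivAt_id p).add ((h1.sub h2).smul_const e)
    refine this.congr_fderiv ?_
    ext x
    simp
  have hk0 : k ≠ 0 := by rintro rfl; simp at hk
  let G := hF.localInverse hF' hk0
  have hFp : F p = p := by simp [F, h0]
  have hG : ContDiffAt ℝ k G p := by
    have := hF.to_localInverse hF' hk0
    rwa [hFp] at this
  have hGp : G p = p := by
    have := hF.localInverse_apply_image hF' hk0
    rwa [hFp] at this
  have hFG : ∀ᶠ x in 𝓝 p, F (G x) = x := by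
    have := (hF.hasStrictFDerivAt' hF' hk0).eventually_right_inverse
    rwa [hFp] at this
  have hG' : HasFDerivAt G (ContinuousLinearMap.id ℝ E) p := by
    have := (hF.hasStrictFDerivAt' hF' hk0).to_localInverse.hasFDerivAt
    rw [hFp] at this
    exact this
  -- Projection along e onto the affine hyperplane p + ker l, which the local inverse of F carries
  -- into {f = 0}. Keeping all of E as source avoids choosing coordinates on the kernel.
  let j : E → E := fun s => p + (s - l s • e)
  have hj0 : j 0 = p := by simp [j]
  have hj : ContDiff ℝ k j := by
    refine contDiff_const.add (contDiff_id.sub (l.contDiff.smul contDiff_const))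
  have hjt : Tendsto j (𝓝 0) (𝓝 p) := by
    have := hj.continuous.tendsto 0
    rwa [hj0] at this
  have hj' : HasFDerivAt j (ContinuousLinearMap.id ℝ E - l.smulRight e) 0 := by
    have := (((hasFDerivAt_id (𝕜 := ℝ) (0 : E)).sub ((l.hasFDerivAt).smul_const e)).const_add p)
    exact this
  refine ⟨G ∘ j, by simp [hj0, hGp], ?_, ?_, fun v hv => ?_⟩
  · refine ContDiffAt.comp 0 ?_ hj.contDiffAt
    rwa [hj0]
  · have hGt : Tendsto (G ∘ j) (𝓝 0) (𝓝 p) := by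
      have := hG.continuousAt.tendsto.comp hjt
      rwa [hGp] at this
    filter_upwards [hjt.eventually hFG, hGt.eventually (hW.mem_nhds hp)] with s hs hs'
    refine ⟨hs', ?_⟩
    have := congrArg l hs
    simp only [F, j, map_add, map_smul, he, map_sub, smul_eq_mul, mul_one] at this
    simp only [Function.comp, j]
    linarith
  · have : HasFDerivAt (G ∘ j) _ 0 := HasFDerivAt.comp 0 (by rw [hj0]; exact hG') hj'
    rw [this.fderiv]
    simp [hv]

theorem tangentVectors_of_eventually {φ : E → E} {x : E} (hφ : DifferentiableAt ℝ φ x)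
    (hS : ∀ᶠ s in 𝓝 x, φ s ∈ S) (w : E) : fderiv ℝ φ x w ∈ tangentVectors S (φ x) := by
  have hl : HasDerivAt (fun t : ℝ => x + t • w) w 0 := by
    simpa using ((hasDerivAt_id (0 : ℝ)).smul_const w).const_add x
  have ht : Tendsto (fun t : ℝ => x + t • w) (𝓝 0) (𝓝 x) := by
    simpa using hl.continuousAt.tendsto
  refine ⟨fun t => φ (x + t • w), by simp, ht.eventually hS, ?_⟩
  have h1 : HasFDerivAt φ (fderiv ℝ φ x) (x + (0 : ℝ) • w) := by
    simpa using hφ.hasFDerivAt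
  exact h1.comp_hasDerivAt 0 hl

theorem fderiv_eq_zero_of_mem_tangentVectors {W : Set E} (hW : IsOpen W) (hp : p ∈ W)
    (hf : DifferentiableAt ℝ f p) (hS : S ∩ W ⊆ {q | f q = 0}) {v : E}
    (hv : v ∈ tangentVectors S p) : fderiv ℝ f p v = 0 := by
  obtain ⟨γ, rfl, hγ, hv⟩ := hv
  have h1 : HasDerivAt (f ∘ γ) (fderiv ℝ f (γ 0) v) 0 := hf.hasFDerivAt.comp_hasDerivAt 0 hv
  have h2 : f ∘ γ =ᶠ[𝓝 0] fun _ => 0 := by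
    filter_upwards [hγ, hv.continuousAt.eventually (hW.mem_nhds hp)] with t h3 h4
    exact hS ⟨h3, h4⟩
  exact h1.unique ((hasDerivAt_const (0 : ℝ) (0 : ℝ)).congr_of_eventuallyEq h2)

end Hypersurface

end Geometry


section Geometry

variable {E : Type*} [NormedAddCommGroup E] [NormedSpace ℝ E]

/-! ### Unit normal fields and their parallelism -/

section UnitNormal

variable {g : E → E →L[ℝ] E →L[ℝ] ℝ} {S W : Set E} {f : E → ℝ} {p : E}

/-- The `g`-gradient of `f` is timelike if the kernel of `df` is spacelike. -/
theorem gradient_timelike {b : E →L[ℝ] E →L[ℝ] ℝ} {l : E →L[ℝ] ℝ} {n t : E}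
    (hsymm : ∀ u v, b u v = b v u) (hn : ∀ v, b n v = l v) (hl : l ≠ 0)
    (hpos : ∀ v, l v = 0 → v ≠ 0 → 0 < b v v) (ht : b t t < 0) : b n n < 0 := by
  have hlt : l t ≠ 0 := fun h => by
    have : t ≠ 0 := by rintro rfl; simp at ht
    linarith [hpos t h this]
  by_contra! hβ
  -- If n were not timelike, its projection to ker l along t would have nonpositive square, so it
  -- would vanish; this forces l n = 0, then n = 0 and l = 0.
  have hu : l (n - (l n / l t) • t) = 0 := by
    simp [hlt]
  have hq : b (n - (l n / l t) • t) (n - (l n / l t) • t) =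
      -(l n) + (l n / l t) ^ 2 * b t t := by
    simp only [map_sub, map_smul, sub_apply, smul_apply, smul_eq_mul, hsymm t n, hn]
    field_simp
    ring
  rw [hn] at hβ
  have hq0 : (l n / l t) ^ 2 * b t t ≤ 0 := mul_nonpos_of_nonneg_of_nonpos (sq_nonneg _) ht.le
  have h0 : n - (l n / l t) • t = 0 := by
    by_contra h
    have := hpos _ hu h
    rw [hq] at this
    linarith
  rw [h0] at hq
  have hln : l n = 0 := by
    simp at hq
    linarith
  have hn0 : n = 0 := by simpa [hln] using h0
  exact hl (ContinuousLinearMap.ext fun v => by simp [← hn, hn0])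

/-- The field is the normalized gradient of f, restricted to the open set where that gradient is
timelike. The normalization holds on all of V, not only on S, so g(N, N) = -1 may be differentiated
in ambient directions. -/
theorem exists_unitNormalField [CompleteSpace E] (hW : IsOpen W)
    (hg : ∀ q ∈ W, ContDiffAt ℝ 2 g q) (hinv : ∀ q ∈ W, (g q).IsInvertible)
    (hf : ContDiffOn ℝ 3 f W) (hS : S ∩ W ⊆ {q | f q = 0}) (hp : p ∈ W)
    (hsymm : ∀ u v, g p u v = g p v u) (hdf : fderiv ℝ f p ≠ 0)
    (hpos : ∀ v, fderiv ℝ f p v = 0 → v ≠ 0 → 0 < g p v v) {t : E} (ht : g p t t < 0) :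
    ∃ (V : Set E) (N : E → E), IsOpen V ∧ p ∈ V ∧ V ⊆ W ∧ ContDiffOn ℝ 2 N V ∧
      (∀ q ∈ V, g q (N q) (N q) = -1) ∧
      ∀ q ∈ S ∩ V, ∀ v ∈ tangentVectors S q, g q (N q) v = 0 := by
  let G : E → E := fun q => (g q).inverse (fderiv ℝ f q)
  have hGg : ∀ q ∈ W, ∀ v, g q (G q) v = fderiv ℝ f q v := fun q hq v => by
    rw [show g q (G q) = fderiv ℝ f q from (hinv q hq).self_apply_inverse _]
  have hG : ContDiffOn ℝ 2 G W := fun q hq => by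
    obtain ⟨e, he⟩ := hinv q hq
    have h1 : ContDiffAt ℝ 2 (ContinuousLinearMap.inverse : (E →L[ℝ] E →L[ℝ] ℝ) → _) (g q) := by
      rw [← he]
      exact contDiffAt_map_inverse e
    have h2 : ContDiffAt ℝ 2 (fun q => (g q).inverse) q := h1.comp q (hg q hq)
    have h3 : ContDiffAt ℝ 2 (fderiv ℝ f) q :=
      (hf.contDiffAt (hW.mem_nhds hq)).fderiv_right (by norm_num)
    exact (h2.clm_apply h3).contDiffWithinAt
  have hβ : ContDiffOn ℝ 2 (fun q => fderiv ℝ f q (G q)) W := fun q hq =>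
    (((hf.contDiffAt (hW.mem_nhds hq)).fderiv_right (m := 2) (by norm_num)).clm_apply
      (hG.contDiffAt (hW.mem_nhds hq))).contDiffWithinAt
  refine ⟨W ∩ (fun q => fderiv ℝ f q (G q)) ⁻¹' Iio 0,
    fun q => (√(-(fderiv ℝ f q (G q))))⁻¹ • G q,
    hβ.continuousOn.isOpen_inter_preimage hW isOpen_Iio, ⟨hp, ?_⟩, inter_subset_left, ?_, ?_, ?_⟩
  · rw [mem_preimage, ← hGg p hp]
    exact gradient_timelike hsymm (hGg p hp) hdf hpos ht
  · refine ContDiffOn.smul (ContDiffOn.inv ?_ ?_) (hG.mono inter_subset_left)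
    · refine ContDiffOn.sqrt (hβ.mono inter_subset_left).neg fun q hq => ?_
      have : fderiv ℝ f q (G q) < 0 := hq.2
      linarith
    · intro q hq
      have : fderiv ℝ f q (G q) < 0 := hq.2
      exact (Real.sqrt_pos.2 (by linarith)).ne'
  · intro q hq
    have h1 : 0 < -(fderiv ℝ f q (G q)) := by
      have : fderiv ℝ f q (G q) < 0 := hq.2
      linarith
    simp only [map_smul, smul_apply, smul_eq_mul, hGg q hq.1]
    have h2 := Real.sq_sqrt h1.le
    have h3 := (Real.sqrt_pos.2 h1).ne'
    field_simp
    linarith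
  · intro q hq v hv
    have hv0 : fderiv ℝ f q v = 0 :=
      fderiv_eq_zero_of_mem_tangentVectors hW hq.2.1
        ((hf.contDiffAt (hW.mem_nhds hq.2.1)).differentiableAt (by simp)) hS hv
    simp [hGg q hq.2.1, hv0]

/-- A unit normal field of a hypersurface with vanishing extrinsic curvature is parallel along
it. -/
theorem parallel_of_zero_curvature {N : E → E} {u : E} (hg : DifferentiableAt ℝ g p)
    (hN : DifferentiableAt ℝ N p) (hinv : (g p).IsInvertible)
    (hsymm : ∀ᶠ q in 𝓝 p, ∀ u v, g q u v = g q v u)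
    (hunit : ∀ᶠ q in 𝓝 p, g q (N q) (N q) = -1)
    (hnormal : ∀ v ∈ tangentVectors S p, g p (N p) v = 0)
    {l : E →L[ℝ] ℝ} (hl : ∀ v, l v = 0 → v ∈ tangentVectors S p)
    (hK : ∀ v ∈ tangentVectors S p, extrinsicCurvature g N p u v = 0) (v : E) :
    g p v (fderiv ℝ N p u) + christoffelFirst g p u (N p) v = 0 := by
  have hs := hsymm.self_of_nhds
  have ht : ∀ v ∈ tangentVectors S p,
      g p v (fderiv ℝ N p u) + christoffelFirst g p u (N p) v = 0 := fun v hv => by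
    have h1 := hK v hv
    have h2 : g p (christoffel g p u (N p)) = christoffelFirst g p u (N p) :=
      hinv.self_apply_inverse _
    rw [extrinsicCurvature, covariantDeriv, map_add, hs v (christoffel g p u (N p)), h2] at h1
    exact h1
  -- The N component comes from differentiating g(N, N) = -1, the tangential ones from the vanishing
  -- of K.
  have hn : g p (N p) (fderiv ℝ N p u) + christoffelFirst g p u (N p) (N p) = 0 := by
    have h1 := ((hg.hasFDerivAt.clm_apply hN.hasFDerivAt).clm_apply hN.hasFDerivAt).unique
      ((hasFDerivAt_const (-1 : ℝ) p).congr_of_eventuallyEq hunit)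
    have h2 := congrArg (fun L : E →L[ℝ] ℝ => L u) h1
    simp at h2
    rw [christoffelFirst_apply, hs (N p)]
    have h3 := hs (N p) (fderiv ℝ N p u)
    linarith
  have hlN : l (N p) ≠ 0 := fun h => by
    have h1 := hnormal _ (hl _ h)
    have h2 := hunit.self_of_nhds
    linarith
  -- N is transversal to ker l, so every v splits into a tangential part and a multiple of N.
  have h0 := ht (v - (l v / l (N p)) • N p) (hl _ (by simp [hlN]))
  simp only [map_sub, map_smul, sub_apply, smul_apply, smul_eq_mul] at h0
  linear_combination h0 + l v / l (N p) * hn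

end UnitNormal

end Geometry


namespace Kruskal

/-! ### The chart functions -/

section Chart

variable {p : Coord}

theorem contDiffAt_timeT {n : WithTop ℕ∞} : ContDiffAt ℝ n timeT p := contDiffAt_fst

theorem contDiffAt_spaceX {n : WithTop ℕ∞} (hp : p.2 ≠ 0) : ContDiffAt ℝ n spaceX p :=
  (contDiffAt_snd.norm ℝ hp).log (norm_ne_zero_iff.2 hp)

theorem contDiffAt_angle {n : WithTop ℕ∞} (hp : p.2 ≠ 0) : ContDiffAt ℝ n angle p :=
  ((contDiffAt_snd.norm ℝ hp).inv (norm_ne_zero_iff.2 hp)).smul contDiffAt_snd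

theorem inner_angle_self (hp : p.2 ≠ 0) : inner ℝ (angle p) (angle p) = 1 := by
  rw [real_inner_self_eq_norm_sq, angle, norm_smul, norm_inv, norm_norm,
    inv_mul_cancel₀ (norm_ne_zero_iff.2 hp), one_pow]

theorem eventually_snd_ne_zero (hp : p.2 ≠ 0) : ∀ᶠ q : Coord in 𝓝 p, q.2 ≠ 0 :=
  continuous_snd.continuousAt.eventually_ne hp

theorem inner_angle_fderiv_angle (hp : p.2 ≠ 0) (v : Coord) :
    inner ℝ (angle p) (fderiv ℝ angle p v) = 0 := by
  have hd : HasFDerivAt angle (fderiv ℝ angle p) p :=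
    ((contDiffAt_angle (n := 1) hp).differentiableAt (by simp)).hasFDerivAt
  have h1 := (hd.inner ℝ hd).unique ((hasFDerivAt_const (1 : ℝ) p).congr_of_eventuallyEq
    ((eventually_snd_ne_zero hp).mono fun q hq => inner_angle_self hq))
  have h2 := congrArg (fun L : Coord →L[ℝ] ℝ => L v) h1
  simp [real_inner_comm] at h2
  linarith

theorem fderiv_timeT (p v : Coord) : fderiv ℝ timeT p v = v.1 := by
  have : HasFDerivAt timeT (ContinuousLinearMap.fst ℝ ℝ (EuclideanSpace ℝ (Fin 3))) p :=
    hasFDerivAt_fst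
  rw [this.fderiv]
  rfl

/-- This is the derivative of y = e^X ω. It recovers a vector from its components dT, dX and dω,
which gives both existence and uniqueness for prescribed components. -/
theorem snd_eq_of_fderiv (hp : p.2 ≠ 0) (v : Coord) :
    v.2 = ‖p.2‖ • (fderiv ℝ spaceX p v • angle p + fderiv ℝ angle p v) := by
  have hd : HasFDerivAt angle (fderiv ℝ angle p) p :=
    ((contDiffAt_angle (n := 1) hp).differentiableAt (by simp)).hasFDerivAt
  have hX : HasFDerivAt spaceX (fderiv ℝ spaceX p) p :=
    ((contDiffAt_spaceX (n := 1) hp).differentiableAt (by simp)).hasFDerivAt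
  have h1 : HasFDerivAt (fun q : Coord => Real.exp (spaceX q) • angle q) _ p := hX.exp.smul hd
  have h2 : HasFDerivAt (fun q : Coord => q.2)
    (ContinuousLinearMap.snd ℝ ℝ (EuclideanSpace ℝ (Fin 3))) p := hasFDerivAt_snd
  have h3 : (fun q : Coord => q.2) =ᶠ[𝓝 p] fun q => Real.exp (spaceX q) • angle q := by
    filter_upwards [eventually_snd_ne_zero hp] with q hq
    rw [spaceX, Real.exp_log (norm_pos_iff.2 hq), angle, smul_smul,
      mul_inv_cancel₀ (norm_ne_zero_iff.2 hq), one_smul]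
  have h4 := congrArg (fun L : Coord →L[ℝ] EuclideanSpace ℝ (Fin 3) => L v)
    (h2.unique (h1.congr_of_eventuallyEq h3))
  have h5 : Real.exp (spaceX p) = ‖p.2‖ := Real.exp_log (norm_pos_iff.2 hp)
  simp only [h5] at h4
  simp only [ContinuousLinearMap.coe_snd', add_apply, smul_apply,
    ContinuousLinearMap.smulRight_apply, smul_eq_mul] at h4
  rw [h4, smul_add, smul_smul, add_comm]

theorem fderiv_spaceX_eq (hp : p.2 ≠ 0) (v : Coord) :
    fderiv ℝ spaceX p v = ‖p.2‖⁻¹ * inner ℝ (angle p) v.2 := by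
  rw [snd_eq_of_fderiv hp v, inner_smul_right, inner_add_right, inner_smul_right,
    inner_angle_self hp, inner_angle_fderiv_angle hp]
  have := norm_ne_zero_iff.2 hp
  field_simp
  ring

/-- Tangent vectors with prescribed `dT`, `dX` and `dω` exist. -/
theorem exists_vector (hp : p.2 ≠ 0) (a b : ℝ) {η : EuclideanSpace ℝ (Fin 3)}
    (hη : inner ℝ (angle p) η = 0) :
    ∃ v, fderiv ℝ timeT p v = a ∧ fderiv ℝ spaceX p v = b ∧ fderiv ℝ angle p v = η := by
  have hn := norm_ne_zero_iff.2 hp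
  let v : Coord := (a, ‖p.2‖ • (b • angle p + η))
  have hX : fderiv ℝ spaceX p v = b := by
    rw [fderiv_spaceX_eq hp, inner_smul_right, inner_add_right, inner_smul_right,
      inner_angle_self hp, hη]
    field_simp
    ring
  refine ⟨v, fderiv_timeT p v, hX, ?_⟩
  have h := snd_eq_of_fderiv hp v
  rw [hX] at h
  exact (add_left_cancel (smul_right_injective _ hn h)).symm

theorem eq_zero_of_fderiv_eq_zero (hp : p.2 ≠ 0) {v : Coord} (hT : fderiv ℝ timeT p v = 0)
    (hX : fderiv ℝ spaceX p v = 0) (hω : fderiv ℝ angle p v = 0) : v = 0 := by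
  refine Prod.ext ?_ ?_
  · rwa [fderiv_timeT] at hT
  · rw [snd_eq_of_fderiv hp, hX, hω]
    simp

theorem fderiv_angle_apply (hp : p.2 ≠ 0) (i : Fin 3) (v : Coord) :
    fderiv ℝ (fun q => angle q i) p v = fderiv ℝ angle p v i := by
  have hd : HasFDerivAt angle (fderiv ℝ angle p) p :=
    ((contDiffAt_angle (n := 1) hp).differentiableAt (by simp)).hasFDerivAt
  have : HasFDerivAt (fun q => angle q i)
      ((EuclideanSpace.proj i : EuclideanSpace ℝ (Fin 3) →L[ℝ] ℝ).comp (fderiv ℝ angle p)) p :=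
    (EuclideanSpace.proj i : EuclideanSpace ℝ (Fin 3) →L[ℝ] ℝ).hasFDerivAt.comp p hd
  rw [this.fderiv]
  rfl

theorem isOpen_spacetime : IsOpen spacetime := by
  rw [isOpen_iff_mem_nhds]
  rintro p ⟨hp, h⟩
  have h1 : ContinuousAt (fun q => timeT q ^ 2 - spaceX q ^ 2) p :=
    ((contDiffAt_timeT (n := 0)).continuousAt.pow 2).sub
      ((contDiffAt_spaceX (n := 0) hp).continuousAt.pow 2)
  exact (eventually_snd_ne_zero hp).and (h1.eventually_lt continuousAt_const h)

end Chart

/-! ### The reduced area radius `r / 2M` -/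

/-- The inverse of `s ↦ (s - 1) e^s`. -/
def kruskalInv (c : ℝ) : ℝ := Function.invFunOn kruskalFun (Ioi 0) c

theorem kruskalInv_pos {c : ℝ} (hc : -1 < c) : 0 < kruskalInv c := by
  have h : c ∈ kruskalFun '' Ioi 0 := by rwa [bijOn_kruskalFun.image_eq]
  exact Function.invFunOn_mem h

theorem kruskalFun_kruskalInv {c : ℝ} (hc : -1 < c) : kruskalFun (kruskalInv c) = c := by
  have h : c ∈ kruskalFun '' Ioi 0 := by rwa [bijOn_kruskalFun.image_eq]
  exact Function.invFunOn_eq h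

theorem hasDerivAt_kruskalFun (s : ℝ) : HasDerivAt kruskalFun (s * Real.exp s) s := by
  have h : HasDerivAt kruskalFun (1 * Real.exp s + (s - 1) * Real.exp s) s :=
    ((hasDerivAt_id s).sub_const 1).mul (Real.hasDerivAt_exp s)
  convert h using 1
  ring

theorem contDiff_kruskalFun {n : WithTop ℕ∞} : ContDiff ℝ n kruskalFun :=
  (contDiff_id.sub contDiff_const).mul Real.contDiff_exp

theorem contDiffAt_kruskalInv {n : WithTop ℕ∞} {c : ℝ} (hc : -1 < c) :
    ContDiffAt ℝ n kruskalInv c := by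
  -- The inverse function theorem needs a nonzero order; continuity follows from the case of order
  -- one.
  wlog hn : n ≠ 0 generalizing n
  · exact (this (n := 1) one_ne_zero).of_le (by simp [not_ne_iff.1 hn])
  set s := kruskalInv c with hs
  have hs0 : 0 < s := kruskalInv_pos hc
  have hfs : kruskalFun s = c := kruskalFun_kruskalInv hc
  have hne : s * Real.exp s ≠ 0 := (mul_pos hs0 (Real.exp_pos s)).ne'
  have hf : ContDiffAt ℝ n kruskalFun s := contDiff_kruskalFun.contDiffAt
  have hf' : HasFDerivAt kruskalFun
      ((ContinuousLinearEquiv.unitsEquivAut ℝ (Units.mk0 _ hne) : ℝ ≃L[ℝ] ℝ) : ℝ →L[ℝ] ℝ) s :=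
    hasDerivAt_kruskalFun s
  have h1 := hf.to_localInverse hf' hn
  have h2 := hf.localInverse_apply_image hf' hn
  have h3 := (hf.hasStrictFDerivAt' hf' hn).eventually_right_inverse
  rw [hfs] at h1 h2 h3
  refine h1.congr_of_eventuallyEq ?_
  -- Near c the local inverse stays positive, so injectivity on the positive axis identifies it with
  -- `kruskalInv`.
  have h4 : ∀ᶠ x in 𝓝 c, 0 < hf.localInverse hf' hn x := by
    refine h1.continuousAt.eventually (lt_mem_nhds ?_)
    rwa [h2]
  filter_upwards [h3, h4, lt_mem_nhds hc] with x h5 h6 h7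
  exact bijOn_kruskalFun.injOn (kruskalInv_pos h7) h6
    ((kruskalFun_kruskalInv h7).trans h5.symm)

theorem hasDerivAt_kruskalInv {c : ℝ} (hc : -1 < c) :
    HasDerivAt kruskalInv (Real.exp (-kruskalInv c) / kruskalInv c) c := by
  have hs0 := kruskalInv_pos hc
  have hne : kruskalInv c * Real.exp (kruskalInv c) ≠ 0 := (mul_pos hs0 (Real.exp_pos _)).ne'
  have := HasDerivAt.of_local_left_inverse (contDiffAt_kruskalInv (n := 0) hc).continuousAt
    (hasDerivAt_kruskalFun _) hne
    ((lt_mem_nhds hc).mono fun x hx => kruskalFun_kruskalInv hx)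
  refine this.congr_deriv ?_
  rw [Real.exp_neg]
  field_simp

/-- The area radius in units of `2M`. -/
def reducedRadius (p : Coord) : ℝ := kruskalInv (spaceX p ^ 2 - timeT p ^ 2)

/-- The derivative of the reduced radius with respect to `X² - T²`. -/
def radiusSlope (p : Coord) : ℝ := Real.exp (-reducedRadius p) / reducedRadius p

section Radius

variable {p : Coord}

theorem reducedRadius_pos (hp : p ∈ spacetime) : 0 < reducedRadius p :=
  kruskalInv_pos (by linarith [hp.2])

theorem radiusSlope_pos (hp : p ∈ spacetime) : 0 < radiusSlope p :=
  div_pos (Real.exp_pos _) (reducedRadius_pos hp)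

/-- The defining relation of r with the exponential absorbed into the slope. Together with the
derivative formulas below it makes the later curvature identity purely rational. -/
theorem reducedRadius_spec (hp : p ∈ spacetime) :
    (spaceX p ^ 2 - timeT p ^ 2) * (reducedRadius p * radiusSlope p) = reducedRadius p - 1 := by
  have h := kruskalFun_kruskalInv (c := spaceX p ^ 2 - timeT p ^ 2) (by linarith [hp.2])
  have hs := (reducedRadius_pos hp).ne'
  rw [← h, radiusSlope, mul_div_cancel₀ _ hs]
  change (reducedRadius p - 1) * Real.exp (reducedRadius p) * Real.exp (-reducedRadius p) = _
  rw [mul_assoc, ← Real.exp_add, add_neg_cancel, Real.exp_zero, mul_one]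

theorem contDiffAt_reducedRadius {n : WithTop ℕ∞} (hp : p ∈ spacetime) :
    ContDiffAt ℝ n reducedRadius p :=
  (contDiffAt_kruskalInv (by linarith [hp.2])).comp p
    (((contDiffAt_spaceX hp.1).pow 2).sub (contDiffAt_timeT.pow 2))

theorem contDiffAt_radiusSlope {n : WithTop ℕ∞} (hp : p ∈ spacetime) :
    ContDiffAt ℝ n radiusSlope p :=
  (contDiffAt_reducedRadius hp).neg.exp.div (contDiffAt_reducedRadius hp)
    (reducedRadius_pos hp).ne'

theorem hasFDerivAt_reducedRadius (hp : p ∈ spacetime) :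
    HasFDerivAt reducedRadius (radiusSlope p •
      ((2 * spaceX p) • fderiv ℝ spaceX p - (2 * timeT p) • fderiv ℝ timeT p)) p := by
  have hX : HasFDerivAt spaceX (fderiv ℝ spaceX p) p :=
    ((contDiffAt_spaceX (n := 1) hp.1).differentiableAt (by simp)).hasFDerivAt
  have hT : HasFDerivAt timeT (fderiv ℝ timeT p) p :=
    ((contDiffAt_timeT (n := 1)).differentiableAt (by simp)).hasFDerivAt
  have := (hasDerivAt_kruskalInv (c := spaceX p ^ 2 - timeT p ^ 2)
    (by linarith [hp.2])).comp_hasFDerivAt p ((hX.pow 2).sub (hT.pow 2))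
  refine this.congr_fderiv ?_
  ext v <;> simp [radiusSlope, reducedRadius]

theorem fderiv_reducedRadius (hp : p ∈ spacetime) (v : Coord) :
    fderiv ℝ reducedRadius p v = 2 * radiusSlope p *
      (spaceX p * fderiv ℝ spaceX p v - timeT p * fderiv ℝ timeT p v) := by
  rw [(hasFDerivAt_reducedRadius hp).fderiv]
  simp
  ring

theorem fderiv_radiusSlope (hp : p ∈ spacetime) (v : Coord) :
    fderiv ℝ radiusSlope p v =
      -(radiusSlope p * (1 + 1 / reducedRadius p)) * fderiv ℝ reducedRadius p v := by
  have hs : HasFDerivAt reducedRadius (fderiv ℝ reducedRadius p) p :=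
    ((contDiffAt_reducedRadius (n := 1) hp).differentiableAt (by simp)).hasFDerivAt
  have h0 := (reducedRadius_pos hp).ne'
  have h1 : HasDerivAt (fun s : ℝ => Real.exp (-s) / s)
      (-(radiusSlope p * (1 + 1 / reducedRadius p))) (reducedRadius p) := by
    have := ((hasDerivAt_neg (reducedRadius p)).exp).div (hasDerivAt_id (reducedRadius p)) h0
    refine this.congr_deriv ?_
    simp only [radiusSlope, id]
    field_simp
    ring
  have := h1.comp_hasFDerivAt p hs
  change fderiv ℝ ((fun s : ℝ => Real.exp (-s) / s) ∘ reducedRadius) p v = _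
  rw [this.fderiv]
  simp

end Radius

end Kruskal


namespace Kruskal

/-! ### The metric in diagonal form -/

/-- The functions `T`, `X`, `ω₁`, `ω₂`, `ω₃`. -/
def coordFun : Option (Option (Fin 3)) → Coord → ℝ
  | none => timeT
  | some none => spaceX
  | some (some i) => fun q => angle q i

/-- The coefficients of the metric with respect to `coordFun`, in units of `4M²`. -/
def metricCoeff : Option (Option (Fin 3)) → Coord → ℝ
  | none => fun q => -(4 * radiusSlope q)
  | some none => fun q => 4 * radiusSlope q
  | some (some _) => fun q => reducedRadius q ^ 2

theorem metric_eq {M : ℝ} (hM : 0 < M) :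
    metric M = diagonalMetric (fun a q => 4 * M ^ 2 * metricCoeff a q) coordFun := by
  funext p
  have hr : radius M p = 2 * M * reducedRadius p := rfl
  have hc : 32 * M ^ 3 / radius M p * Real.exp (-radius M p / (2 * M)) =
      4 * M ^ 2 * (4 * radiusSlope p) := by
    rw [hr, radiusSlope, neg_div, mul_div_cancel_left₀ _ (by positivity : 2 * M ≠ 0)]
    -- Outside the space-time the radius may be 0; division by zero then makes both sides 0, so the
    -- identity holds at every point of the chart.
    by_cases h : reducedRadius p = 0
    · simp [h]
    · field_simp
      ring
  refine ContinuousLinearMap.ext fun v => ContinuousLinearMap.ext fun w => ?_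
  rw [metric_apply, hc, hr, diagonalMetric_apply]
  simp only [Fintype.sum_option, metricCoeff, coordFun, ← Finset.mul_sum]
  ring

section Metric

variable {M : ℝ} {p : Coord}

theorem contDiffAt_coordFun {n : WithTop ℕ∞} (hp : p.2 ≠ 0) (a : Option (Option (Fin 3))) :
    ContDiffAt ℝ n (coordFun a) p := by
  rcases a with _ | _ | i
  · exact contDiffAt_timeT
  · exact contDiffAt_spaceX hp
  · exact (EuclideanSpace.proj i : EuclideanSpace ℝ (Fin 3) →L[ℝ] ℝ).contDiff.contDiffAt.comp p
      (contDiffAt_angle hp)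

theorem contDiffAt_metricCoeff {n : WithTop ℕ∞} (hp : p ∈ spacetime)
    (a : Option (Option (Fin 3))) : ContDiffAt ℝ n (metricCoeff a) p := by
  have h1 : ContDiffAt ℝ n (fun q => 4 * radiusSlope q) p :=
    contDiffAt_const.mul (contDiffAt_radiusSlope hp)
  rcases a with _ | _ | i
  · exact h1.neg
  · exact h1
  · exact (contDiffAt_reducedRadius hp).pow 2

theorem contDiffAt_metric {n : ℕ} (hM : 0 < M) (hp : p ∈ spacetime) :
    ContDiffAt ℝ n (metric M) p := by
  rw [metric_eq hM]
  exact contDiffAt_diagonalMetric (m := n + 1) le_rfl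
    (fun a => contDiffAt_const.mul (contDiffAt_metricCoeff hp a))
    fun a => contDiffAt_coordFun hp.1 a

theorem metric_symm (M : ℝ) (p u v : Coord) : metric M p u v = metric M p v u := by
  simp only [metric_apply, mul_comm]

theorem sum_mul_inner (x y : EuclideanSpace ℝ (Fin 3)) :
    ∑ i, x i * y i = inner ℝ x y := by
  simp [PiLp.inner_apply, mul_comm]

theorem metric_eq_inner (hM : 0 < M) (hp : p.2 ≠ 0) (v w : Coord) :
    metric M p v w = 4 * M ^ 2 *
      (4 * radiusSlope p * (-(fderiv ℝ timeT p v * fderiv ℝ timeT p w)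
        + fderiv ℝ spaceX p v * fderiv ℝ spaceX p w)
      + reducedRadius p ^ 2 * inner ℝ (fderiv ℝ angle p v) (fderiv ℝ angle p w)) := by
  simp only [metric_eq hM, diagonalMetric_apply, Fintype.sum_option, metricCoeff, coordFun,
    fderiv_angle_apply hp, ← Finset.mul_sum, sum_mul_inner]
  ring

/-- A vector in the kernel is tested against ∂_T, ∂_X and its own angular part; in finite dimension
injectivity is enough. -/
theorem isInvertible_metric (hM : 0 < M) (hp : p ∈ spacetime) : (metric M p).IsInvertible := by
  have hinj : Function.Injective (metric M p) := by
    rw [injective_iff_map_eq_zero]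
    intro v hv
    have hQ := (radiusSlope_pos hp).ne'
    have hs := (reducedRadius_pos hp).ne'
    have h : ∀ w, metric M p v w = 0 := fun w => by rw [hv]; rfl
    simp only [metric_eq_inner hM hp.1] at h
    refine eq_zero_of_fderiv_eq_zero hp.1 ?_ ?_ ?_
    · obtain ⟨w, h1, h2, h3⟩ := exists_vector hp.1 1 0 (inner_zero_right (𝕜 := ℝ) (angle p))
      simpa [h1, h2, h3, hQ, hM.ne'] using h w
    · obtain ⟨w, h1, h2, h3⟩ := exists_vector hp.1 0 1 (inner_zero_right (𝕜 := ℝ) (angle p))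
      simpa [h1, h2, h3, hQ, hM.ne'] using h w
    · obtain ⟨w, h1, h2, h3⟩ := exists_vector hp.1 0 0 (inner_angle_fderiv_angle hp.1 v)
      simpa [h1, h2, h3, hs, hM.ne'] using h w
  have hdim : Module.finrank ℝ Coord = Module.finrank ℝ (Coord →L[ℝ] ℝ) := by
    rw [← (LinearMap.toContinuousLinearMap : (Coord →ₗ[ℝ] ℝ) ≃ₗ[ℝ] _).finrank_eq]
    exact (Subspace.dual_finrank_eq).symm
  let e : Coord ≃ₗ[ℝ] (Coord →L[ℝ] ℝ) :=
    LinearEquiv.ofInjectiveOfFinrankEq (metric M p : Coord →ₗ[ℝ] Coord →L[ℝ] ℝ) hinj hdim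
  exact ⟨e.toContinuousLinearEquiv, by ext <;> rfl⟩

/-- The form `g(v, ∇_u N)` of the Kruskal metric, in units of `4M²`. -/
theorem metric_add_christoffelFirst (hM : 0 < M) (hp : p ∈ spacetime) {N : Coord → Coord}
    (hN : DifferentiableAt ℝ N p) (u v : Coord) :
    metric M p v (fderiv ℝ N p u) + christoffelFirst (metric M) p u (N p) v =
      4 * M ^ 2 * (
        4 * radiusSlope p *
          (fderiv ℝ spaceX p v * fderiv ℝ (fun q => fderiv ℝ spaceX q (N q)) p u
            - fderiv ℝ timeT p v * fderiv ℝ (fun q => fderiv ℝ timeT q (N q)) p u)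
        + reducedRadius p ^ 2 *
          inner ℝ (fderiv ℝ angle p v) (fderiv ℝ (fun q => fderiv ℝ angle q (N q)) p u)
        + 2 * (fderiv ℝ radiusSlope p u *
            (fderiv ℝ spaceX p (N p) * fderiv ℝ spaceX p v
              - fderiv ℝ timeT p (N p) * fderiv ℝ timeT p v)
          + fderiv ℝ radiusSlope p (N p) *
            (fderiv ℝ spaceX p u * fderiv ℝ spaceX p v - fderiv ℝ timeT p u * fderiv ℝ timeT p v)
          - fderiv ℝ radiusSlope p v *
            (fderiv ℝ spaceX p u * fderiv ℝ spaceX p (N p)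
              - fderiv ℝ timeT p u * fderiv ℝ timeT p (N p)))
        + reducedRadius p * (
          fderiv ℝ reducedRadius p u * inner ℝ (fderiv ℝ angle p (N p)) (fderiv ℝ angle p v)
          + fderiv ℝ reducedRadius p (N p) * inner ℝ (fderiv ℝ angle p u) (fderiv ℝ angle p v)
          - fderiv ℝ reducedRadius p v *
            inner ℝ (fderiv ℝ angle p u) (fderiv ℝ angle p (N p)))) := by
  have hs : HasFDerivAt reducedRadius (fderiv ℝ reducedRadius p) p :=
    ((contDiffAt_reducedRadius (n := 1) hp).differentiableAt (by simp)).hasFDerivAt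
  have hQ : HasFDerivAt radiusSlope (fderiv ℝ radiusSlope p) p :=
    ((contDiffAt_radiusSlope (n := 1) hp).differentiableAt (by simp)).hasFDerivAt
  have h1 : ∀ w, fderiv ℝ (fun q => 4 * M ^ 2 * -(4 * radiusSlope q)) p w =
      -(16 * M ^ 2 * fderiv ℝ radiusSlope p w) := fun w => by
    have h : HasFDerivAt (fun q => 4 * M ^ 2 * -(4 * radiusSlope q)) _ p :=
      (hQ.const_mul 4).neg.const_mul (4 * M ^ 2)
    rw [h.fderiv]
    simp
    ring
  have h2 : ∀ w, fderiv ℝ (fun q => 4 * M ^ 2 * (4 * radiusSlope q)) p w =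
      16 * M ^ 2 * fderiv ℝ radiusSlope p w := fun w => by
    rw [((hQ.const_mul 4).const_mul (4 * M ^ 2)).fderiv]
    simp
    ring
  have h3 : ∀ w, fderiv ℝ (fun q => 4 * M ^ 2 * reducedRadius q ^ 2) p w =
      8 * M ^ 2 * reducedRadius p * fderiv ℝ reducedRadius p w := fun w => by
    rw [((hs.pow 2).const_mul (4 * M ^ 2)).fderiv]
    simp
    ring
  have h4 : ∀ i : Fin 3, fderiv ℝ (fun q => fderiv ℝ (fun q => angle q i) q (N q)) p u =
      fderiv ℝ (fun q => fderiv ℝ angle q (N q)) p u i := fun i => by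
    have hd : HasFDerivAt (fun q => fderiv ℝ angle q (N q)) _ p :=
      (((contDiffAt_angle (n := 2) hp.1).fderiv_right (m := 1) (by norm_num)).differentiableAt
        (by simp)).clm_apply hN |>.hasFDerivAt
    have h5 : HasFDerivAt (fun q => fderiv ℝ angle q (N q) i)
        ((EuclideanSpace.proj i : EuclideanSpace ℝ (Fin 3) →L[ℝ] ℝ).comp
          (fderiv ℝ (fun q => fderiv ℝ angle q (N q)) p)) p :=
      (EuclideanSpace.proj i : EuclideanSpace ℝ (Fin 3) →L[ℝ] ℝ).hasFDerivAt.comp p hd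
    have h6 : (fun q => fderiv ℝ (fun q => angle q i) q (N q)) =ᶠ[𝓝 p]
        fun q => fderiv ℝ angle q (N q) i :=
      (eventually_snd_ne_zero hp.1).mono fun q hq => fderiv_angle_apply hq i (N q)
    rw [h6.fderiv_eq, h5.fderiv]
    rfl
  rw [metric_eq hM, diagonalMetric_add_christoffelFirst
    (fun a => contDiffAt_const.mul (contDiffAt_metricCoeff hp a))
    (fun a => contDiffAt_coordFun hp.1 a) hN]
  simp only [Fintype.sum_option, metricCoeff, coordFun, h1, h2, h3, h4,
    fderiv_angle_apply hp.1, ← sum_mul_inner, Fin.sum_univ_three]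
  ring

end Metric

end Kruskal


namespace Kruskal

/-! ### Parallel vector fields along a hypersurface -/

section Parallel

variable {M : ℝ} {p u : Coord} {N : Coord → Coord}

theorem contDiffAt_fderiv_angle_apply {n : ℕ} (hp : p ∈ spacetime) (hN : ContDiffAt ℝ n N p) :
    ContDiffAt ℝ n (fun q => fderiv ℝ angle q (N q)) p :=
  ((contDiffAt_angle (n := n + 1) hp.1).fderiv_right le_rfl).clm_apply hN

theorem contDiffAt_fderiv_reducedRadius_apply {n : ℕ} (hp : p ∈ spacetime)
    (hN : ContDiffAt ℝ n N p) : ContDiffAt ℝ n (fun q => fderiv ℝ reducedRadius q (N q)) p :=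
  ((contDiffAt_reducedRadius (n := n + 1) hp).fderiv_right le_rfl).clm_apply hN

/-- The angular part of the equation `∇_u N = 0`. -/
theorem angular_parallel (hM : 0 < M) (hp : p ∈ spacetime) (hN : DifferentiableAt ℝ N p)
    (hpar : ∀ v, metric M p v (fderiv ℝ N p u) + christoffelFirst (metric M) p u (N p) v = 0)
    {η : EuclideanSpace ℝ (Fin 3)} (hη : inner ℝ (angle p) η = 0) :
    reducedRadius p * inner ℝ η (fderiv ℝ (fun q => fderiv ℝ angle q (N q)) p u) +
      fderiv ℝ reducedRadius p u * inner ℝ η (fderiv ℝ angle p (N p)) +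
      fderiv ℝ reducedRadius p (N p) * inner ℝ η (fderiv ℝ angle p u) = 0 := by
  obtain ⟨v, hT, hX, hω⟩ := exists_vector hp.1 0 0 hη
  have h := hpar v
  have hs := (reducedRadius_pos hp).ne'
  have hsv : fderiv ℝ reducedRadius p v = 0 := by simp [fderiv_reducedRadius hp, hT, hX]
  rw [metric_add_christoffelFirst hM hp hN, fderiv_radiusSlope hp v, hsv, hT, hX, hω,
    real_inner_comm η, real_inner_comm η] at h
  have h' := (mul_eq_zero.1 h).resolve_left (by positivity)
  apply mul_left_cancel₀ hs
  linear_combination h'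

/-- The radial part of the equation `∇_u N = 0`, contracted with the gradient of the radius. -/
theorem radial_parallel (hM : 0 < M) (hp : p ∈ spacetime) (hN : ContDiffAt ℝ 1 N p)
    (hpar : ∀ v, metric M p v (fderiv ℝ N p u) + christoffelFirst (metric M) p u (N p) v = 0)
    (horth : metric M p (N p) u = 0) :
    fderiv ℝ (fun q => fderiv ℝ reducedRadius q (N q)) p u =
      (reducedRadius p - 3 / 2) * inner ℝ (fderiv ℝ angle p (N p)) (fderiv ℝ angle p u) := by
  have hNd : DifferentiableAt ℝ N p := hN.differentiableAt (by simp)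
  have hs := (reducedRadius_pos hp).ne'
  have hQ := (radiusSlope_pos hp).ne'
  have hT : HasFDerivAt timeT (fderiv ℝ timeT p) p :=
    ((contDiffAt_timeT (n := 1)).differentiableAt (by simp)).hasFDerivAt
  have hX : HasFDerivAt spaceX (fderiv ℝ spaceX p) p :=
    ((contDiffAt_spaceX (n := 1) hp.1).differentiableAt (by simp)).hasFDerivAt
  have hQd : HasFDerivAt radiusSlope (fderiv ℝ radiusSlope p) p :=
    ((contDiffAt_radiusSlope (n := 1) hp).differentiableAt (by simp)).hasFDerivAt
  have hNT : HasFDerivAt (fun q => fderiv ℝ timeT q (N q))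
      (fderiv ℝ (fun q => fderiv ℝ timeT q (N q)) p) p :=
    ((((contDiffAt_timeT (n := 2)).fderiv_right (m := 1) (by norm_num)).clm_apply
      hN).differentiableAt (by simp)).hasFDerivAt
  have hNX : HasFDerivAt (fun q => fderiv ℝ spaceX q (N q))
      (fderiv ℝ (fun q => fderiv ℝ spaceX q (N q)) p) p :=
    ((((contDiffAt_spaceX (n := 2) hp.1).fderiv_right (m := 1) (by norm_num)).clm_apply
      hN).differentiableAt (by simp)).hasFDerivAt
  have hy : (fun q => fderiv ℝ reducedRadius q (N q)) =ᶠ[𝓝 p] fun q => 2 * radiusSlope q *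
      (spaceX q * fderiv ℝ spaceX q (N q) - timeT q * fderiv ℝ timeT q (N q)) :=
    (isOpen_spacetime.eventually_mem hp).mono fun q hq => fderiv_reducedRadius hq (N q)
  have hy' : HasFDerivAt (fun q => 2 * radiusSlope q *
      (spaceX q * fderiv ℝ spaceX q (N q) - timeT q * fderiv ℝ timeT q (N q))) _ p :=
    (hQd.const_mul 2).mul ((hX.mul hNX).sub (hT.mul hNT))
  -- The vector T ∂_T + X ∂_X is proportional to the gradient of r.
  obtain ⟨v, hvT, hvX, hvω⟩ := exists_vector hp.1 (timeT p) (spaceX p)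
    (inner_zero_right (𝕜 := ℝ) (angle p))
  have h := hpar v
  rw [metric_eq_inner hM hp.1] at horth
  rw [metric_add_christoffelFirst hM hp hNd] at h
  have horth' := (mul_eq_zero.1 horth).resolve_left (by positivity)
  have h' := (mul_eq_zero.1 h).resolve_left (by positivity)
  have hspec := reducedRadius_spec hp
  rw [hy.fderiv_eq, hy'.fderiv]
  simp only [fderiv_radiusSlope hp, fderiv_reducedRadius hp, hvT, hvX, hvω, inner_zero_left,
    inner_zero_right] at h'
  rw [real_inner_comm (fderiv ℝ angle p (N p)) (fderiv ℝ angle p u)] at h'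
  simp only [add_apply, sub_apply, smul_apply, smul_eq_mul, fderiv_radiusSlope hp,
    fderiv_reducedRadius hp]
  generalize inner ℝ (fderiv ℝ angle p (N p)) (fderiv ℝ angle p u) = κ at *
  generalize fderiv ℝ (fun q => fderiv ℝ timeT q (N q)) p u = T' at *
  generalize fderiv ℝ (fun q => fderiv ℝ spaceX q (N q)) p u = X' at *
  generalize fderiv ℝ timeT p u = a at *
  generalize fderiv ℝ spaceX p u = b at *
  generalize fderiv ℝ timeT p (N p) = c at *
  generalize fderiv ℝ spaceX p (N p) = d at *
  generalize reducedRadius p = s at *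
  generalize radiusSlope p = Q at *
  generalize timeT p = T at *
  generalize spaceX p = X at *
  -- Orthogonality of N and u trades their (T, X) product for the angular one κ, and the defining
  -- relation of r eliminates X² - T²; this leaves the factor s - 3/2.
  linear_combination (norm := (field_simp; ring)) h' / 2 +
    (1 / 2 - Q * (1 + 1 / s) * (X ^ 2 - T ^ 2) / 2) * horth' + κ * ((s + 3) / 2) * hspec

theorem eq_inner_smul_of_forall_inner_eq_zero {F : Type*} [NormedAddCommGroup F]
    [InnerProductSpace ℝ F] {ω x : F} (hω : inner ℝ ω ω = 1)
    (h : ∀ η, inner ℝ ω η = 0 → inner ℝ η x = 0) : x = inner ℝ ω x • ω := by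
  have h0 : inner ℝ ω (x - inner ℝ ω x • ω) = 0 := by
    rw [inner_sub_right, inner_smul_right, hω, mul_one, sub_self]
  refine sub_eq_zero.1 (inner_self_eq_zero (𝕜 := ℝ).1 ?_)
  rw [inner_sub_right, h _ h0, inner_smul_right, real_inner_comm ω, h0, mul_zero, sub_zero]

/-- The `ℝ³`-valued function `s ν + ds(N) ω`, where `s` is the reduced radius and `ν` the angular
part of `N`. -/
def angularField (N : Coord → Coord) (q : Coord) : EuclideanSpace ℝ (Fin 3) :=
  reducedRadius q • fderiv ℝ angle q (N q) + fderiv ℝ reducedRadius q (N q) • angle q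

theorem contDiffAt_angularField {n : ℕ} (hp : p ∈ spacetime) (hN : ContDiffAt ℝ n N p) :
    ContDiffAt ℝ n (angularField N) p :=
  ((contDiffAt_reducedRadius hp).smul (contDiffAt_fderiv_angle_apply hp hN)).add
    ((contDiffAt_fderiv_reducedRadius_apply hp hN).smul (contDiffAt_angle hp.1))

/-- Tested against η orthogonal to ω, the derivative is the left side of the angular equation, so
only an ω component survives. That component is s⟨ω, dν(u)⟩ + dy(u); differentiating ⟨ω, ν⟩ = 0
turns the first term into -s⟨ν, dω(u)⟩, which cancels the s in s - 3/2. -/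
theorem fderiv_angularField (hM : 0 < M) (hp : p ∈ spacetime) (hN : ContDiffAt ℝ 1 N p)
    (hpar : ∀ v, metric M p v (fderiv ℝ N p u) + christoffelFirst (metric M) p u (N p) v = 0)
    (horth : metric M p (N p) u = 0) :
    fderiv ℝ (angularField N) p u =
      (-(3 / 2) * inner ℝ (fderiv ℝ angle p (N p)) (fderiv ℝ angle p u)) • angle p := by
  have hs : HasFDerivAt reducedRadius (fderiv ℝ reducedRadius p) p :=
    ((contDiffAt_reducedRadius (n := 1) hp).differentiableAt (by simp)).hasFDerivAt
  have hω : HasFDerivAt angle (fderiv ℝ angle p) p :=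
    ((contDiffAt_angle (n := 1) hp.1).differentiableAt (by simp)).hasFDerivAt
  have hν : HasFDerivAt (fun q => fderiv ℝ angle q (N q))
      (fderiv ℝ (fun q => fderiv ℝ angle q (N q)) p) p :=
    ((contDiffAt_fderiv_angle_apply (n := 1) hp hN).differentiableAt (by simp)).hasFDerivAt
  have hy : HasFDerivAt (fun q => fderiv ℝ reducedRadius q (N q))
      (fderiv ℝ (fun q => fderiv ℝ reducedRadius q (N q)) p) p :=
    ((contDiffAt_fderiv_reducedRadius_apply (n := 1) hp hN).differentiableAt
      (by simp)).hasFDerivAt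
  have hz : HasFDerivAt (angularField N) _ p := (hs.smul hν).add (hy.smul hω)
  have hνω : inner ℝ (angle p) (fderiv ℝ (fun q => fderiv ℝ angle q (N q)) p u) =
      -inner ℝ (fderiv ℝ angle p (N p)) (fderiv ℝ angle p u) := by
    have h1 := (hω.inner ℝ hν).unique ((hasFDerivAt_const (0 : ℝ) p).congr_of_eventuallyEq
      ((eventually_snd_ne_zero hp.1).mono fun q hq => inner_angle_fderiv_angle hq (N q)))
    have h2 := congrArg (fun L : Coord →L[ℝ] ℝ => L u) h1
    simp at h2
    rw [real_inner_comm (fderiv ℝ angle p u)]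
    linarith
  have hx : fderiv ℝ (angularField N) p u =
      reducedRadius p • fderiv ℝ (fun q => fderiv ℝ angle q (N q)) p u +
      fderiv ℝ reducedRadius p u • fderiv ℝ angle p (N p) +
      (fderiv ℝ reducedRadius p (N p) • fderiv ℝ angle p u +
      fderiv ℝ (fun q => fderiv ℝ reducedRadius q (N q)) p u • angle p) := by
    rw [hz.fderiv]
    simp
  have hself := inner_angle_self hp.1
  rw [eq_inner_smul_of_forall_inner_eq_zero (x := fderiv ℝ (angularField N) p u) hself
    fun η hη => ?_]
  · congr 1
    rw [hx]
    simp only [inner_add_right, inner_smul_right, hνω, hself, inner_angle_fderiv_angle hp.1,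
      radial_parallel hM hp hN hpar horth]
    ring
  · have h := angular_parallel hM hp (hN.differentiableAt (by simp)) hpar hη
    rw [hx]
    rw [real_inner_comm] at hη
    simp only [inner_add_right, inner_smul_right, hη]
    linarith

end Parallel

end Kruskal


/-! ### Integrability and auxiliary facts -/

/-- Integrability condition for `dζ = α ω`: modulo `ω`, the form `α ∧ dω` vanishes. -/
theorem mul_inner_fderiv_comm_of_fderiv_eq_smul {E F : Type*} [NormedAddCommGroup E]
    [NormedSpace ℝ E] [NormedAddCommGroup F] [InnerProductSpace ℝ F] {ζ ω : E → F}
    {α : E → E → ℝ} {x : E} (hζ : ContDiffAt ℝ 2 ζ x)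
    (hα : ∀ w, DifferentiableAt ℝ (fun s => α s w) x) (hω : DifferentiableAt ℝ ω x)
    (h : ∀ᶠ s in 𝓝 x, ∀ w, fderiv ℝ ζ s w = α s w • ω s) {e : F} (he : inner ℝ e (ω x) = 0)
    (v w : E) :
    α x w * inner ℝ e (fderiv ℝ ω x v) = α x v * inner ℝ e (fderiv ℝ ω x w) := by
  have h2 : HasFDerivAt (fderiv ℝ ζ) (fderiv ℝ (fderiv ℝ ζ) x) x :=
    ((hζ.fderiv_right (m := 1) (by norm_num)).differentiableAt (by simp)).hasFDerivAt
  have key : ∀ v w, inner ℝ e (fderiv ℝ (fderiv ℝ ζ) x v w) =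
      α x w * inner ℝ e (fderiv ℝ ω x v) := fun v w => by
    have h3 := (h2.clm_apply (hasFDerivAt_const w x)).unique
      (((hα w).hasFDerivAt.smul hω.hasFDerivAt).congr_of_eventuallyEq (h.mono fun s hs => hs w))
    have h4 := congrArg (fun L : E →L[ℝ] F => inner ℝ e (L v)) h3
    simpa [inner_add_right, inner_smul_right, he] using h4
  have hsymm : fderiv ℝ (fderiv ℝ ζ) x v w = fderiv ℝ (fderiv ℝ ζ) x w v :=
    hζ.isSymmSndFDerivAt (by simp) v w
  rw [← key v w, hsymm, key w v]

theorem exists_ne_zero_inner_eq_zero (x y : EuclideanSpace ℝ (Fin 3)) :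
    ∃ e : EuclideanSpace ℝ (Fin 3), e ≠ 0 ∧ inner ℝ x e = 0 ∧ inner ℝ y e = 0 := by
  let L : EuclideanSpace ℝ (Fin 3) →ₗ[ℝ] ℝ × ℝ :=
    ((innerSL ℝ x).prod (innerSL ℝ y) : EuclideanSpace ℝ (Fin 3) →L[ℝ] ℝ × ℝ)
  obtain ⟨e, he, he0⟩ := (Submodule.ne_bot_iff _).1
    (LinearMap.ker_ne_bot_of_finrank_lt (f := L) (by simp))
  have := Prod.mk.inj (LinearMap.mem_ker.1 he)
  exact ⟨e, he0, this.1, this.2⟩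

theorem three_le_of_two_lt {k : WithTop ℕ∞} (hk : 2 < k) : 3 ≤ k := by
  cases k with
  | top => exact le_top
  | coe k =>
    have h : (2 : ℕ∞) + 1 ≤ k := Order.add_one_le_of_lt (WithTop.coe_lt_coe.1 hk)
    rw [two_add_one_eq_three] at h
    exact WithTop.coe_le_coe.2 h

namespace Kruskal

/-! ### Time-symmetric hypersurfaces in the Kruskal space-time -/

section TimeSymmetric

variable {M : ℝ} {p : Coord} {S : Set Coord}

/-- A parallel unit normal field of a hypersurface that submerses onto the sphere has no angular
component. -/
theorem fderiv_angle_normal_eq_zero (hM : 0 < M) (hp : p ∈ spacetime) {N φ : Coord → Coord}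
    (hN : ContDiffAt ℝ 2 N p) (hφ0 : φ 0 = p) (hφ : ContDiffAt ℝ 2 φ 0)
    (hpar : ∀ᶠ s in 𝓝 (0 : Coord), ∀ w,
      (∀ v, metric M (φ s) v (fderiv ℝ N (φ s) (fderiv ℝ φ s w)) +
        christoffelFirst (metric M) (φ s) (fderiv ℝ φ s w) (N (φ s)) v = 0) ∧
      metric M (φ s) (N (φ s)) (fderiv ℝ φ s w) = 0)
    (hsurj : ∀ η, inner ℝ (angle p) η = 0 → ∃ w, fderiv ℝ angle p (fderiv ℝ φ 0 w) = η) :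
    fderiv ℝ angle p (N p) = 0 := by
  subst hφ0
  have hd : ∀ᶠ s in 𝓝 (0 : Coord), DifferentiableAt ℝ φ s :=
    (hφ.eventually (by simp)).mono fun s hs => hs.differentiableAt (by simp)
  have hmem : ∀ᶠ s in 𝓝 (0 : Coord), φ s ∈ spacetime :=
    hφ.continuousAt.eventually (isOpen_spacetime.mem_nhds hp)
  have hN' : ∀ᶠ s in 𝓝 (0 : Coord), ContDiffAt ℝ 1 N (φ s) :=
    hφ.continuousAt.eventually ((hN.eventually (by simp)).mono fun q hq =>
      hq.of_le (by norm_num))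
  have hωφ : ∀ s w, φ s ∈ spacetime → DifferentiableAt ℝ φ s →
      fderiv ℝ (angle ∘ φ) s w = fderiv ℝ angle (φ s) (fderiv ℝ φ s w) := fun s w h1 h2 => by
    rw [fderiv_comp s ((contDiffAt_angle (n := 1) h1.1).differentiableAt (by simp)) h2]
    rfl
  have hωc : ContDiffAt ℝ 2 (angle ∘ φ) 0 := (contDiffAt_angle hp.1).comp 0 hφ
  have hνc : ContDiffAt ℝ 1 (fun s => fderiv ℝ angle (φ s) (N (φ s))) 0 :=
    (((contDiffAt_fderiv_angle_apply (n := 2) hp hN).comp 0 hφ).of_le (by norm_num))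
  have hζ : ContDiffAt ℝ 2 (angularField N ∘ φ) 0 :=
    (contDiffAt_angularField (n := 2) hp hN).comp 0 hφ
  let α : Coord → Coord → ℝ := fun s w =>
    -(3 / 2) * inner ℝ (fderiv ℝ angle (φ s) (N (φ s))) (fderiv ℝ (angle ∘ φ) s w)
  have hα : ∀ w, DifferentiableAt ℝ (fun s => α s w) 0 := fun w => by
    have h1 : ContDiffAt ℝ 1 (fun s => fderiv ℝ (angle ∘ φ) s w) 0 :=
      (hωc.fderiv_right (m := 1) (by norm_num)).clm_apply contDiffAt_const
    exact ((hνc.inner ℝ h1).differentiableAt (by simp)).const_mul _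
  have hdζ : ∀ᶠ s in 𝓝 (0 : Coord), ∀ w,
      fderiv ℝ (angularField N ∘ φ) s w = α s w • (angle ∘ φ) s := by
    filter_upwards [hd, hmem, hN', hpar] with s h1 h2 h3 h4 w
    rw [fderiv_comp s ((contDiffAt_angularField (n := 1) h2 h3).differentiableAt (by simp)) h1]
    simp only [α, hωφ s w h2 h1]
    exact fderiv_angularField hM h2 h3 (h4 w).1 (h4 w).2
  -- With e orthogonal to ω and ν, dω(v) = ν and dω(w) = e, the integrability condition reads 0 =
  -- -(3/2)|ν|²|e|².
  obtain ⟨e, he0, he1, he2⟩ :=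
    exists_ne_zero_inner_eq_zero (angle (φ 0)) (fderiv ℝ angle (φ 0) (N (φ 0)))
  obtain ⟨v, hv⟩ := hsurj _ (inner_angle_fderiv_angle hp.1 (N (φ 0)))
  obtain ⟨w, hw⟩ := hsurj e he1
  have key := mul_inner_fderiv_comm_of_fderiv_eq_smul hζ hα
    (hωc.differentiableAt (by simp)) hdζ (e := e) (by rw [real_inner_comm]; exact he1) v w
  simp only [α, hωφ 0 _ hp hd.self_of_nhds, hv, hw, he2] at key
  have hee : inner ℝ e e ≠ 0 := inner_self_ne_zero.2 he0
  have h0 : inner ℝ (fderiv ℝ angle (φ 0) (N (φ 0))) (fderiv ℝ angle (φ 0) (N (φ 0))) = 0 := by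
    apply mul_right_cancel₀ hee
    linarith
  exact inner_self_eq_zero.1 h0

theorem exists_timelike (hM : 0 < M) (hp : p ∈ spacetime) :
    ∃ t, fderiv ℝ angle p t = 0 ∧ metric M p t t < 0 := by
  obtain ⟨t, h1, h2, h3⟩ := exists_vector hp.1 1 0 (inner_zero_right (𝕜 := ℝ) (angle p))
  refine ⟨t, h3, ?_⟩
  rw [metric_eq_inner hM hp.1, h1, h2, h3]
  have := radiusSlope_pos hp
  simp
  positivity

/-- A spacelike hypersurface has local parametrizations, and submerses onto the sphere. -/
theorem exists_parametrization_of_isSpacelike (hM : 0 < M) {k : WithTop ℕ∞} (hk : 3 ≤ k)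
    (hS : IsEmbeddedHypersurface k spacetime S) (hsp : IsSpacelike (metric M) S) (hp : p ∈ S) :
    ∃ (φ : Coord → Coord) (l : Coord →L[ℝ] ℝ), φ 0 = p ∧ ContDiffAt ℝ 2 φ 0 ∧
      (∀ᶠ s in 𝓝 0, φ s ∈ S) ∧ (∀ v, l v = 0 → v ∈ tangentVectors S p) ∧
      ∀ η, inner ℝ (angle p) η = 0 → ∃ w, fderiv ℝ angle p (fderiv ℝ φ 0 w) = η := by
  have hpm := hS.1 hp
  obtain ⟨W, f, hW, hpW, hWO, hf, hdf, hSW⟩ := hS.2 p hp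
  have hfp : f p = 0 := by
    have : p ∈ {q ∈ W | f q = 0} := hSW ▸ ⟨hp, hpW⟩
    exact this.2
  obtain ⟨φ, hφ0, hφ, hφS, hφ'⟩ :=
    exists_parametrization hW hpW (le_trans (by norm_num) hk) hf hdf hfp
  have hφ2 : ContDiffAt ℝ 2 φ 0 := hφ.of_le (le_trans (by norm_num) hk)
  have hφS' : ∀ᶠ s in 𝓝 0, φ s ∈ S := hφS.mono fun s hs => by
    have : φ s ∈ S ∩ W := hSW ▸ hs
    exact this.1
  have htan : ∀ v, fderiv ℝ f p v = 0 → v ∈ tangentVectors S p := fun v hv => by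
    have := tangentVectors_of_eventually (hφ2.differentiableAt (by simp)) hφS' v
    rwa [hφ0, hφ' v hv] at this
  refine ⟨φ, fderiv ℝ f p, hφ0, hφ2, hφS', htan, fun η hη => ?_⟩
  obtain ⟨t, ht1, ht2⟩ := exists_timelike hM hpm
  have hlt : fderiv ℝ f p t ≠ 0 := fun h => by
    have ht0 : t ≠ 0 := by rintro rfl; simp at ht2
    have := hsp p hp t (htan t h) ht0
    linarith
  obtain ⟨v, -, -, hv⟩ := exists_vector hpm.1 0 0 hη
  -- Subtracting a multiple of t makes v tangent to S without changing dω(v), because dω(t) = 0.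
  refine ⟨v - (fderiv ℝ f p v / fderiv ℝ f p t) • t, ?_⟩
  rw [hφ' _ (by simp [hlt])]
  simp [hv, ht1]

/-- A time-symmetric hypersurface meets neither of the two regions `T ≥ |X|`, `T ≤ -|X|`, except
possibly at the bifurcation sphere `T = X = 0`. -/
theorem not_sq_le_sq_of_isTimeSymmetric (hM : 0 < M) {k : WithTop ℕ∞} (hk : 3 ≤ k)
    (hS : IsEmbeddedHypersurface k spacetime S) (hsym : IsTimeSymmetric (metric M) S)
    (hp : p ∈ S) (hT : timeT p ≠ 0) : ¬ spaceX p ^ 2 ≤ timeT p ^ 2 := by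
  intro hXT
  have hpm := hS.1 hp
  obtain ⟨W, f, hW, hpW, hWO, hf, hdf, hSW⟩ := hS.2 p hp
  obtain ⟨t, -, ht⟩ := exists_timelike hM hpm
  have hfp : f p = 0 := by
    have : p ∈ {q ∈ W | f q = 0} := hSW ▸ ⟨hp, hpW⟩
    exact this.2
  have hpos : ∀ v, fderiv ℝ f p v = 0 → v ≠ 0 → 0 < metric M p v v := fun v hv hv0 => by
    obtain ⟨φ, hφ0, hφ, hφS, hφ'⟩ :=
      exists_parametrization hW hpW (le_trans (by norm_num) hk) hf hdf hfp
    have h1 := tangentVectors_of_eventually (S := S)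
      (hφ.differentiableAt (by rintro rfl; simp at hk)) (hφS.mono fun s hs => by
        have : φ s ∈ S ∩ W := hSW ▸ hs
        exact this.1) v
    rw [hφ0, hφ' v hv] at h1
    exact hsym.spacelike p hp v h1 hv0
  obtain ⟨V, N, hV, hpV, hVW, hN, hunit, hnormal⟩ :=
    exists_unitNormalField (g := metric M) (S := S) hW
      (fun q hq => contDiffAt_metric (n := 2) hM (hWO hq))
      (fun q hq => isInvertible_metric hM (hWO hq)) (hf.of_le hk)
      (fun q hq => by
        rw [hSW] at hq
        exact hq.2) hpW (metric_symm M p) hdf hpos ht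
  have hNf : IsUnitNormalField (metric M) S V N :=
    ⟨hN.of_le (by norm_num), fun q hq => hunit q hq.2, hnormal⟩
  have hN2 : ∀ q ∈ V, ContDiffAt ℝ 2 N q := fun q hq => hN.contDiffAt (hV.mem_nhds hq)
  have hpar : ∀ q ∈ S ∩ V, ∀ u ∈ tangentVectors S q, ∀ v,
      metric M q v (fderiv ℝ N q u) + christoffelFirst (metric M) q u (N q) v = 0 := by
    intro q hq u hu
    obtain ⟨φ, l, -, -, -, hl, -⟩ :=
      exists_parametrization_of_isSpacelike hM hk hS hsym.spacelike hq.1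
    exact parallel_of_zero_curvature
      ((contDiffAt_metric (n := 1) hM (hS.1 hq.1)).differentiableAt (by simp))
      ((hN2 q hq.2).differentiableAt (by simp)) (isInvertible_metric hM (hS.1 hq.1))
      (Eventually.of_forall fun q => metric_symm M q)
      ((hV.eventually_mem hq.2).mono hunit) (hnormal q hq) hl
      fun v hv => hsym.zero_curvature q hq.1 V N hV hq.2 hNf u hu v hv
  -- Needed at all nearby points of S, not only at p, since ν is differentiated along S below.
  have hang : ∀ q ∈ S ∩ V, fderiv ℝ angle q (N q) = 0 := by
    intro q hq
    obtain ⟨φ, l, hφ0, hφ, hφS, -, hsurj⟩ :=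
      exists_parametrization_of_isSpacelike hM hk hS hsym.spacelike hq.1
    refine fderiv_angle_normal_eq_zero hM (hS.1 hq.1) (hN2 q hq.2) hφ0 hφ ?_ hsurj
    have hφV : ∀ᶠ s in 𝓝 (0 : Coord), φ s ∈ V :=
      hφ.continuousAt.eventually (by rw [hφ0]; exact hV.eventually_mem hq.2)
    filter_upwards [hφV, hφS, hφS.eventually_nhds, hφ.eventually (by simp)] with s h1 h2 h3 h4 w
    have hu := tangentVectors_of_eventually (h4.differentiableAt (by simp)) h3 w
    exact ⟨hpar _ ⟨h2, h1⟩ _ hu, hnormal _ ⟨h2, h1⟩ _ hu⟩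
  obtain ⟨φ, l, hφ0, hφ, hφS, -, hsurj⟩ :=
    exists_parametrization_of_isSpacelike hM hk hS hsym.spacelike hp
  have hφV : ∀ᶠ s in 𝓝 (0 : Coord), φ s ∈ V :=
    hφ.continuousAt.eventually (by rw [hφ0]; exact hV.eventually_mem hpV)
  obtain ⟨η, hη0, hη, -⟩ := exists_ne_zero_inner_eq_zero (angle p) 0
  obtain ⟨w, hw⟩ := hsurj η hη
  have hφd : DifferentiableAt ℝ φ 0 := hφ.differentiableAt (by simp)
  have hu : fderiv ℝ φ 0 w ∈ tangentVectors S p := by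
    have := tangentVectors_of_eventually hφd hφS w
    rwa [hφ0] at this
  have hν : fderiv ℝ (fun q => fderiv ℝ angle q (N q)) p (fderiv ℝ φ 0 w) = 0 := by
    have h1 : DifferentiableAt ℝ (fun q => fderiv ℝ angle q (N q)) (φ 0) := by
      rw [hφ0]
      exact (contDiffAt_fderiv_angle_apply (n := 2) hpm (hN2 p hpV)).differentiableAt (by simp)
    have h2 : (fun q => fderiv ℝ angle q (N q)) ∘ φ =ᶠ[𝓝 0] fun _ => 0 := by
      filter_upwards [hφV, hφS] with s h3 h4 using hang _ ⟨h4, h3⟩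
    have h3 := congrArg (fun L : Coord →L[ℝ] EuclideanSpace ℝ (Fin 3) => L w)
      ((fderiv_comp 0 h1 hφd).symm.trans h2.fderiv_eq)
    simpa [hφ0] using h3
  have hy := angular_parallel hM hpm ((hN2 p hpV).differentiableAt (by simp))
    (hpar p ⟨hp, hpV⟩ _ hu) hη
  -- With ν and its tangential derivative zero, the angular equation is y|η|² = 0.
  rw [hν, hang p ⟨hp, hpV⟩, hw, inner_zero_right, mul_zero, mul_zero, zero_add, zero_add,
    fderiv_reducedRadius hpm] at hy
  have hQ := radiusSlope_pos hpm
  have hy' := (mul_eq_zero.1 ((mul_eq_zero.1 hy).resolve_right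
    (inner_self_ne_zero.2 hη0))).resolve_left (by positivity)
  have hNN := hunit p hpV
  rw [metric_eq_inner hM hpm.1, hang p ⟨hp, hpV⟩, inner_zero_left] at hNN
  set c := fderiv ℝ timeT p (N p)
  set d := fderiv ℝ spaceX p (N p)
  have hcd : d ^ 2 < c ^ 2 := by
    by_contra! h
    have : 0 ≤ 4 * M ^ 2 * (4 * radiusSlope p * (d ^ 2 - c ^ 2)) := by
      have := sub_nonneg.2 h
      positivity
    linarith
  have hT2 : 0 < timeT p ^ 2 := by positivity
  -- Here y = 0 says X d = T c, whereas N timelike gives d² < c²; these are incompatible with X² ≤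
  -- T² and T ≠ 0.
  have h1 : (spaceX p * d) ^ 2 = (timeT p * c) ^ 2 := by rw [sub_eq_zero.1 hy']
  have h2 : timeT p ^ 2 * d ^ 2 < timeT p ^ 2 * c ^ 2 := mul_lt_mul_of_pos_left hcd hT2
  have h3 : spaceX p ^ 2 * d ^ 2 ≤ timeT p ^ 2 * d ^ 2 :=
    mul_le_mul_of_nonneg_right hXT (sq_nonneg d)
  linarith

theorem timeT_ne_zero_of_mem_interior {A : Set Coord} {ε : ℝ}
    (hA : ∀ q ∈ A, 0 ≤ ε * timeT q) (hε : ε ≠ 0) (hp : p ∈ interior A) : timeT p ≠ 0 := by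
  intro h0
  -- From a point with T = 0 this curve moves in the forbidden time direction: along it ε T = -ε² t
  -- < 0 for t > 0.
  have hc : Tendsto (fun t : ℝ => ((-(ε * t), p.2) : Coord)) (𝓝 0) (𝓝 p) := by
    have h1 : Continuous fun t : ℝ => ((-(ε * t), p.2) : Coord) := by fun_prop
    have h2 := h1.tendsto 0
    have h3 : ((-(ε * 0), p.2) : Coord) = p := Prod.ext (by rw [mul_zero, neg_zero]; exact h0.symm) rfl
    rwa [h3] at h2
  have h1 := (hc.eventually (mem_interior_iff_mem_nhds.1 hp)).filter_mono
    (nhdsWithin_le_nhds (s := Ioi 0))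
  obtain ⟨t, ht, ht0⟩ := (h1.and self_mem_nhdsWithin).exists
  have h2 := hA _ ht
  have h3 : 0 < ε ^ 2 * t := mul_pos (by positivity) ht0
  simp only [timeT] at h2
  linarith

end TimeSymmetric

end Kruskal

end

theorem proposition1 (M : ℝ) (hM : 0 < M) (k : WithTop ℕ∞) (hk : 2 < k)
    (S : Set Kruskal.Coord)
    (hS : IsEmbeddedHypersurface k Kruskal.spacetime S)
    (hsym : IsTimeSymmetric (Kruskal.metric M) S) :
    Disjoint S (interior Kruskal.futureBlackHole) ∧
      Disjoint S (interior Kruskal.pastBlackHole) := by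
  have hk3 := three_le_of_two_lt hk
  refine ⟨Set.disjoint_left.2 fun p hp hB => ?_, Set.disjoint_left.2 fun p hp hB => ?_⟩
  · have hT := Kruskal.timeT_ne_zero_of_mem_interior (ε := 1)
      (fun q hq => by simpa using (abs_nonneg _).trans hq.2) one_ne_zero hB
    refine Kruskal.not_sq_le_sq_of_isTimeSymmetric hM hk3 hS hsym hp hT (sq_le_sq.2 ?_)
    exact (interior_subset hB).2.trans (le_abs_self _)
  · have hT := Kruskal.timeT_ne_zero_of_mem_interior (ε := -1)
      (fun q hq => by
        have := (abs_nonneg _).trans (le_neg_of_le_neg hq.2)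
        linarith) (by norm_num) hB
    refine Kruskal.not_sq_le_sq_of_isTimeSymmetric hM hk3 hS hsym hp hT (sq_le_sq.2 ?_)
    exact (le_neg_of_le_neg (interior_subset hB).2).trans (neg_le_abs _)
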